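/- Let $p$ be a prime. A normal subgroup of finite $p$-index is a normal subgroup whose index is a power of $p$. A subgroup $Y$ of a group $X$ is called $p$-separable (in $X$) if for every $g\in X\setminus Y$ there is a homomorphism $\psi$ of $X$ onto a finite $p$-group with $\psi(g)\notin\psi(Y)$; $X$ is residually $p$-finite if its trivial subgroup is $p$-separable. A subgroup $Y$ of $X$ is called $p'$-isolated if, for every $g\in X$ and every prime $q\neq p$, $g^q\in Y$ implies $g\in Y$. For a group $X$, let $\Delta^p_X$ be the family of all $p'$-isolated cyclic subgroups of $X$ that are not $p$-separable in $X$. **Theorem 1.7.** Let $A$ and $B$ be groups, $H\leqslant A$ and $K\leqslant B$ subgroups, $\varphi\colon H\to K$ an isomorphism, and $G=(A*B;\ H=K,\varphi)$ the free product of $A$ and $B$ with $H$ and $K$ amalgamated according to $\varphi$; regard $A$ and $B$ as subgroups of $G$. Let $\Omega^p$ be the family of all pairs $(A\cap N, B\cap N)$, where $N$ is a normal subgroup of $G$ of finite $p$-index. Suppose that $A$ and $B$ are residually $p$-finite, that $H$ is $p$-separable in $A$ and $K$ is $p$-separable in $B$, and that for any normal subgroups $M\leqslant A$ and $N\leqslant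 B$ of finite $p$-index there is a pair $(R,S)\in\Omega^p$ with $R\leqslant M$ and $S\leqslant N$. Then $G$ satisfies $(**)$ every $p'$-isolated cyclic subgroup of $G$ that is not conjugate in $G$ to any subgroup in $\Delta^p_A\cup\Delta^p_B$ is $p$-separable in $G$. -/

import Mathlib

/-! Generalized free products of two groups and separability in the class of finite `p`-groups. -/

universe u v

/-- A subgroup `Y` of `X` is separable by the finite `p`-groups if every `g ∉ Y` is sent outside
the image of `Y` by some homomorphism of `X` onto a finite `p`-group. (Such an image is a quotient
of `X`, so nothing is lost by taking it in the universe of `X`.) -/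
def PSeparable (p : ℕ) {X : Type u} [Group X] (Y : Subgroup X) : Prop :=
  ∀ g : X, g ∉ Y → ∃ (P : Type u) (_ : Group P) (_ : Finite P) (ψ : X →* P),
    IsPGroup p P ∧ Function.Surjective ψ ∧ ψ g ∉ Y.map ψ

/-- A group is residually `p`-finite if its trivial subgroup is `p`-separable. -/
def ResiduallyPFinite (p : ℕ) (X : Type u) [Group X] : Prop :=
  PSeparable p (⊥ : Subgroup X)

/-- A subgroup `Y` of `X` is `p'`-isolated if, for every `g` in `X` and every prime `q ≠ p`,
`g ^ q ∈ Y` implies `g ∈ Y`. -/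
def PPrimeIsolated (p : ℕ) {X : Type u} [Group X] (Y : Subgroup X) : Prop :=
  ∀ (g : X) (q : ℕ), q.Prime → q ≠ p → g ^ q ∈ Y → g ∈ Y

/-- A normal subgroup of finite `p`-index: its index is a power of `p`. -/
def NormalOfPIndex (p : ℕ) {X : Type u} [Group X] (N : Subgroup X) : Prop :=
  N.Normal ∧ ∃ k : ℕ, N.index = p ^ k

/-- The family of the `p'`-isolated cyclic subgroups of `X` that are not `p`-separable in `X`. -/
def DeltaP (p : ℕ) (X : Type u) [Group X] : Set (Subgroup X) :=
  {D | IsCyclic D ∧ PPrimeIsolated p D ∧ ¬ PSeparable p D}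

/-- Conjugacy of subgroups. -/
def ConjugateSubgroups {X : Type u} [Group X] (C D : Subgroup X) : Prop :=
  ∃ g : X, C = D.map (MulAut.conj g).toMonoidHom

section Amalgam

variable {A : Type u} {B : Type v} [Group A] [Group B] {H : Subgroup A} {K : Subgroup B}

/-- The normal subgroup of the free product `A * B` generated by all `h (φ h)⁻¹`, `h ∈ H`. -/
def amalgamKernel (φ : H ≃* K) : Subgroup (Monoid.Coprod A B) :=
  Subgroup.normalClosure (Set.range fun h : H =>
    (Monoid.Coprod.inl (h : A) * (Monoid.Coprod.inr (φ h : B))⁻¹ : Monoid.Coprod A B))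

instance amalgamKernel_normal (φ : H ≃* K) : (amalgamKernel φ).Normal :=
  Subgroup.normalClosure_normal

/-- The free product `(A * B; H = K, φ)` of `A` and `B` with the subgroups `H` and `K`
amalgamated according to the isomorphism `φ`. -/
abbrev Amalgam (φ : H ≃* K) : Type (max u v) :=
  Monoid.Coprod A B ⧸ amalgamKernel φ

namespace Amalgam

/-- The canonical embedding of the factor `A`. -/
def inl (φ : H ≃* K) : A →* Amalgam φ :=
  (QuotientGroup.mk' (amalgamKernel φ)).comp Monoid.Coprod.inl

/-- The canonical embedding of the factor `B`. -/
def inr (φ : H ≃* K) : B →* Amalgam φ :=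
  (QuotientGroup.mk' (amalgamKernel φ)).comp Monoid.Coprod.inr

end Amalgam

/-- The family of all pairs `(A ∩ N, B ∩ N)`, where `N` is a normal subgroup of finite `p`-index
of the amalgamated product; the intersections are taken as subgroups of `A` and of `B`. -/
def OmegaP (p : ℕ) (φ : H ≃* K) : Set (Subgroup A × Subgroup B) :=
  {RS | ∃ N : Subgroup (Amalgam φ), NormalOfPIndex p N ∧
    RS = (N.comap (Amalgam.inl φ), N.comap (Amalgam.inr φ))}

/-- Every `p'`-isolated cyclic subgroup of the amalgamated product that is not conjugate to a
member of `DeltaP p A` or `DeltaP p B` (viewed in the product) is `p`-separable. -/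
def ConditionStarStar (p : ℕ) (φ : H ≃* K) : Prop :=
  ∀ C : Subgroup (Amalgam φ), IsCyclic C → PPrimeIsolated p C →
    (∀ D ∈ DeltaP p A, ¬ ConjugateSubgroups C (D.map (Amalgam.inl φ))) →
    (∀ D ∈ DeltaP p B, ¬ ConjugateSubgroups C (D.map (Amalgam.inr φ))) →
    PSeparable p C

end Amalgam

/-! ### Syllable decomposition in free groups. -/

namespace FreeGroup

variable {α : Type*}

/-! Write `U` for the amalgamated subgroup of `G`. If a normal subgroup `N` of finite `p`-index is
small, finitely many given elements of the factors outside `U` stay outside `U` modulo `N`. The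
hypothesis on the family of pairs says exactly that such `N` form a proper filter, so finitely many
such demands can be met at once.

For each `N` there is a homomorphism `labelHom` from `G` to the wreath product of a free group with
`G ⧸ N`: `A` goes to the complement, and `B` to its conjugate by a generic base element that
commutes with the image of `U`. Its coordinates record the edges crossed by a word in the graph of
cosets modulo `N`, so a word alternating modulo `N` has a reduced label of known length. Finite
`p`-quotients of the free group induce finite `p`-quotients of the wreath product, and free groups
are residually finite `p`-groups.

If a generator `c` is conjugate into a factor, its subgroup is `p`-separable in that factor, and
this passes to `G` because the factors themselves are `p`-separable (`pSeparable_left`).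

Otherwise `c` is conjugate to a cyclically reduced word, whose label has a length `k > 0`. Let `n`
be the part of `k` prime to `p`. For `g` outside the isolated subgroup of `c`, also `g ^ n` lies
outside it, and comparing label lengths leaves only finitely many powers of `c` to avoid; hence some
`labelHom` keeps `g ^ n` outside the powers of `c`. If no finite `p`-quotient separated `g` from
`c`, then `g` times a power of `c` would give some `x ∈ N` whose label is inseparable from that of
`d = c ^ p ^ j ∈ N`. In a free group this makes both labels powers of one element, and the
cyclically reduced label of `d`, of length `k * p ^ j`, bounds the prime-to-`p` part of the missing
root by `n`: the `n`-th power of the label of `x` is a power of that of `d`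
(`pow_mem_zpowers_of_forall_map_mem`). One coordinate determines `labelHom` on `N`, which gives a
contradiction. -/

theorem exists_syllables (g : FreeGroup α) :
    ∃ l : List (α × ℤ), (∀ s ∈ l, s.2 ≠ 0) ∧ l.IsChain (fun s t => s.1 ≠ t.1) ∧
      g = (l.map fun s => of s.1 ^ s.2).prod := by
  classical
  have key : ∀ (i : α) (n : ℤ) (l : List (α × ℤ)), (∀ s ∈ l, s.2 ≠ 0) →
      l.IsChain (fun s t => s.1 ≠ t.1) →
      ∃ l' : List (α × ℤ), (∀ s ∈ l', s.2 ≠ 0) ∧ l'.IsChain (fun s t => s.1 ≠ t.1) ∧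
      of i ^ n * (l.map fun s => of s.1 ^ s.2).prod = (l'.map fun s => of s.1 ^ s.2).prod := by
    intro i n l h0 hc
    by_cases hn : n = 0
    · exact ⟨l, h0, hc, by simp [hn]⟩
    cases l with
    | nil => exact ⟨[(i, n)], by simpa using hn, by simp, by simp⟩
    | cons s t =>
      by_cases hi : i = s.1
      · subst hi
        by_cases hs : n + s.2 = 0
        · refine ⟨t, fun x hx => h0 x (by simp [hx]), hc.tail, ?_⟩
          simp [← mul_assoc, ← zpow_add, hs]
        · refine ⟨(s.1, n + s.2) :: t, ?_, ?_, ?_⟩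
          · intro x hx
            rcases List.mem_cons.1 hx with rfl | hx
            · exact hs
            · exact h0 x (by simp [hx])
          · rw [List.isChain_cons] at hc ⊢
            exact hc
          · simp [← mul_assoc, ← zpow_add]
      · refine ⟨(i, n) :: s :: t, ?_, ?_, by simp⟩
        · intro x hx
          rcases List.mem_cons.1 hx with rfl | hx
          · exact hn
          · exact h0 x hx
        · exact List.isChain_cons_cons.2 ⟨hi, hc⟩
  induction g using FreeGroup.induction_on with
  | C1 => exact ⟨[], by simp, by simp, by simp⟩
  | of i =>
    obtain ⟨l', h1, h2, h3⟩ := key i 1 [] (by simp) (by simp)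
    exact ⟨l', h1, h2, by simpa using h3⟩
  | inv_of i _ =>
    obtain ⟨l', h1, h2, h3⟩ := key i (-1) [] (by simp) (by simp)
    exact ⟨l', h1, h2, by simpa using h3⟩
  | mul x y hx hy =>
    obtain ⟨l, h1, h2, rfl⟩ := hx
    obtain ⟨m, h3, h4, rfl⟩ := hy
    clear h2
    induction l with
    | nil => exact ⟨m, h3, h4, by simp⟩
    | cons s t ih =>
      obtain ⟨l', h5, h6, h7⟩ := ih (fun x hx => h1 x (by simp [hx]))
      obtain ⟨l'', h8, h9, h10⟩ := key s.1 s.2 l' h5 h6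
      exact ⟨l'', h8, h9, by rw [← h10, ← h7]; simp [mul_assoc]⟩

end FreeGroup

/-! ### Unitriangular matrices over `ZMod (p ^ K)` form a `p`-group. -/

/-- After `n` Frobenius steps the nilpotent part is gone modulo `p`; every further `p`-th power
gains at least one factor `p`. -/
theorem one_add_pow_prime_pow_eq_one {R : Type*} [Ring R] {p : ℕ} (hp : p.Prime) {a : R} {n K : ℕ}
    (ha : a ^ n = 0) (hK : (p : R) ^ K = 0) : ∃ t : ℕ, (1 + a) ^ p ^ t = 1 := by
  have h1 : ∃ b : R, (1 + a) ^ p ^ n = 1 + p * b := by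
    have h := Commute.add_pow_prime_pow_eq hp (Commute.one_left a) n
    have h2 : a ^ p ^ n = 0 :=
      pow_eq_zero_of_le (Nat.lt_pow_self hp.one_lt).le ha
    rw [h2] at h
    exact ⟨a * ∑ k ∈ Finset.Ioo 0 (p ^ n), 1 ^ (k - 1) * a ^ (p ^ n - k - 1) * ↑((p ^ n).choose k / p),
      by rw [h, one_pow, add_zero, mul_one, mul_assoc]⟩
  have h3 : ∀ m : ℕ, ∃ b : R, (1 + a) ^ p ^ (n + m) = 1 + (p : R) ^ (m + 1) * b := by
    intro m
    induction m with
    | zero => simpa using h1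
    | succ m ih =>
      obtain ⟨b, hb⟩ := ih
      have hc : Commute (p : R) b := (Nat.cast_commute p b)
      have h := Commute.add_pow_prime_eq hp (Commute.one_left ((p : R) ^ (m + 1) * b))
      rw [← add_assoc, pow_succ, pow_mul, hb, h]
      have h5 : ((p : R) ^ (m + 1) * b) ^ p = (p : R) ^ (m + 2) *
          ((p : R) ^ ((m + 1) * p - (m + 2)) * b ^ p) := by
        rw [(hc.pow_left _).mul_pow, ← mul_assoc, ← pow_add, ← pow_mul]
        congr 2
        have := hp.two_le
        have : (m + 1) * 2 ≤ (m + 1) * p := Nat.mul_le_mul_left _ this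
        omega
      refine ⟨(p : R) ^ ((m + 1) * p - (m + 2)) * b ^ p +
        b * ∑ k ∈ Finset.Ioo 0 p, 1 ^ (k - 1) * ((p : R) ^ (m + 1) * b) ^ (p - k - 1) *
          ↑(p.choose k / p), ?_⟩
      rw [h5, one_pow, mul_one, mul_add, pow_succ' (p : R) (m + 1)]
      simp only [mul_assoc, add_assoc]
  obtain ⟨b, hb⟩ := h3 K
  exact ⟨n + K, by rw [hb, pow_succ, hK]; simp⟩

/-- The group of units `u` of a matrix ring such that `u - 1` and `u⁻¹ - 1` are strictly upper
triangular. -/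
def unitriangularUnits (m : ℕ) (R : Type*) [CommRing R] : Subgroup (Matrix (Fin m) (Fin m) R)ˣ where
  carrier := {u | (∀ i j, j ≤ i → (u.1 - 1) i j = 0) ∧ ∀ i j, j ≤ i → (u⁻¹.1 - 1) i j = 0}
  one_mem' := by simp
  inv_mem' := by
    intro u hu
    exact ⟨hu.2, by simpa using hu.1⟩
  mul_mem' := by
    have key : ∀ a b : Matrix (Fin m) (Fin m) R, (∀ i j, j ≤ i → (a - 1) i j = 0) →
        (∀ i j, j ≤ i → (b - 1) i j = 0) → ∀ i j, j ≤ i → (a * b - 1) i j = 0 := by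
      intro a b ha hb i j hij
      have h : a * b - 1 = (a - 1) * (b - 1) + (a - 1) + (b - 1) := by noncomm_ring
      rw [h, Matrix.add_apply, Matrix.add_apply, ha i j hij, hb i j hij, Matrix.mul_apply]
      simp only [add_zero]
      refine Finset.sum_eq_zero fun k _ => ?_
      rcases le_or_gt k i with hk | hk
      · rw [ha i k hk, zero_mul]
      · rw [hb k j (hij.trans hk.le), mul_zero]
    intro u v hu hv
    refine ⟨key _ _ hu.1 hv.1, ?_⟩
    rw [mul_inv_rev]
    exact key _ _ hv.2 hu.2

theorem isPGroup_unitriangularUnits {p : ℕ} (hp : p.Prime) (m K : ℕ) :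
    IsPGroup p (unitriangularUnits m (ZMod (p ^ K))) := by
  rintro ⟨u, hu⟩
  -- Each factor `u - 1` pushes the support up by one diagonal.
  have hnil : ∀ k : ℕ, ∀ i j : Fin m, (j : ℕ) < i + k → ((u.1 - 1) ^ k) i j = 0 := by
    intro k
    induction k with
    | zero =>
      intro i j hij
      rw [pow_zero, Matrix.one_apply_ne]
      rintro rfl
      omega
    | succ k ih =>
      intro i j hij
      rw [pow_succ, Matrix.mul_apply]
      refine Finset.sum_eq_zero fun x _ => ?_
      rcases lt_or_ge (x : ℕ) (i + k) with hx | hx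
      · rw [ih i x hx, zero_mul]
      · rw [hu.1 x j (Fin.le_def.2 (by omega)), mul_zero]
  have h0 : (u.1 - 1) ^ m = 0 := by
    ext i j
    exact hnil m i j (by omega)
  have hK : ((p : ℕ) : Matrix (Fin m) (Fin m) (ZMod (p ^ K))) ^ K = 0 := by
    rw [← Nat.cast_pow]
    ext i j
    rw [Matrix.natCast_apply]
    simp
  obtain ⟨t, ht⟩ := one_add_pow_prime_pow_eq_one hp h0 hK
  refine ⟨t, ?_⟩
  ext1
  ext1
  simpa using ht

/-! ### Residual `p`-finiteness of free groups. -/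

namespace FreeGroup

variable {α : Type*}

/-- The strictly upper triangular matrix whose entry at `(k, k + 1)` is `1` if the `k`-th syllable
of `l` is a power of the generator `i`, all other entries being zero. -/
def syllableMatrix (R : Type*) [CommRing R] [DecidableEq α] (l : List (α × ℤ)) (i : α) :
    Matrix (Fin (l.length + 1)) (Fin (l.length + 1)) R :=
  fun s t => if (s : ℕ) + 1 = t ∧ (l[(s : ℕ)]?).map Prod.fst = some i then 1 else 0

/-- A nonzero entry of the square would need two consecutive syllables on the same generator. -/
theorem syllableMatrix_mul_self (R : Type*) [CommRing R] [DecidableEq α] {l : List (α × ℤ)}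
    (hl : l.IsChain fun s t => s.1 ≠ t.1) (i : α) :
    syllableMatrix R l i * syllableMatrix R l i = 0 := by
  ext s t
  rw [Matrix.mul_apply]
  refine Finset.sum_eq_zero fun u _ => ?_
  unfold syllableMatrix
  by_cases h : ((s : ℕ) + 1 = u ∧ (l[(s : ℕ)]?).map Prod.fst = some i) ∧
      ((u : ℕ) + 1 = t ∧ (l[(u : ℕ)]?).map Prod.fst = some i)
  · exfalso
    obtain ⟨⟨h1, h2⟩, h3, h4⟩ := h
    rw [← h1] at h4
    have h5 : (s : ℕ) + 1 < l.length := by omega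
    have h6 := List.isChain_iff_getElem.1 hl s h5
    rw [List.getElem?_eq_getElem (by omega)] at h2 h4
    simp only [Option.map_some, Option.some.injEq] at h2 h4
    exact h6 (h2.trans h4.symm)
  · rw [not_and_or] at h
    rcases h with h | h
    · rw [if_neg h, zero_mul]
    · rw [if_neg h, mul_zero]

/-- The unit `1 + syllableMatrix R l i`. -/
def syllableUnit (R : Type*) [CommRing R] [DecidableEq α] {l : List (α × ℤ)}
    (hl : l.IsChain fun s t => s.1 ≠ t.1) (i : α) :
    (Matrix (Fin (l.length + 1)) (Fin (l.length + 1)) R)ˣ where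
  val := 1 + syllableMatrix R l i
  inv := 1 - syllableMatrix R l i
  val_inv := by
    have := syllableMatrix_mul_self R hl i
    simp [mul_sub, add_mul, this]
  inv_val := by
    have := syllableMatrix_mul_self R hl i
    simp [mul_add, sub_mul, this]

theorem syllableUnit_mem (R : Type*) [CommRing R] [DecidableEq α] {l : List (α × ℤ)}
    (hl : l.IsChain fun s t => s.1 ≠ t.1) (i : α) :
    syllableUnit R hl i ∈ unitriangularUnits (l.length + 1) R := by
  have h : ∀ s t : Fin (l.length + 1), t ≤ s → syllableMatrix R l i s t = 0 := by
    intro s t hst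
    have : ¬ ((s : ℕ) + 1 = t) := by have := Fin.le_def.1 hst; omega
    simp [syllableMatrix, this]
  constructor
  · intro s t hst
    simpa [syllableUnit] using h s t hst
  · intro s t hst
    have : (syllableUnit R hl i)⁻¹.1 - 1 = - syllableMatrix R l i := by
      change 1 - syllableMatrix R l i - 1 = _
      abel
    rw [this, Matrix.neg_apply, h s t hst, neg_zero]

theorem coe_syllableUnit_zpow (R : Type*) [CommRing R] [DecidableEq α] {l : List (α × ℤ)}
    (hl : l.IsChain fun s t => s.1 ≠ t.1) (i : α) (n : ℤ) :
    ((syllableUnit R hl i ^ n : (Matrix _ _ R)ˣ) : Matrix _ _ R) =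
      1 + (n : R) • syllableMatrix R l i := by
  have h0 := syllableMatrix_mul_self R hl i
  induction n using Int.induction_on with
  | zero => simp
  | succ n ih =>
    rw [zpow_add_one, Units.val_mul, ih]
    change (1 + _) * (1 + syllableMatrix R l i) = _
    push_cast
    simp [mul_add, add_mul, h0, add_smul, add_assoc]
  | pred n ih =>
    rw [zpow_sub_one, Units.val_mul, ih]
    change (1 + _) * (1 - syllableMatrix R l i) = _
    push_cast
    simp only [mul_sub, add_mul, h0, sub_smul, one_mul, mul_one, smul_mul_assoc, smul_zero, one_smul]
    abel

/-- Free groups are residually finite `p`-groups. -/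
theorem exists_isPGroup_map_ne_one {p : ℕ} (hp : p.Prime) {g : FreeGroup α} (hg : g ≠ 1) :
    ∃ (T : Type) (_ : Group T) (_ : Finite T) (τ : FreeGroup α →* T), IsPGroup p T ∧ τ g ≠ 1 := by
  classical
  obtain ⟨l, h0, hl, rfl⟩ := exists_syllables g
  have hprod : (l.map Prod.snd).prod ≠ 0 := by
    rw [Ne, List.prod_eq_zero_iff]
    rintro h
    obtain ⟨s, hs, h1⟩ := List.mem_map.1 h
    exact h0 s hs h1
  -- For a nonzero integer `m`, the power `p ^ |m|` exceeds `|m|` and so does not divide `m`.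
  obtain ⟨K, hK⟩ : ∃ K : ℕ, ((l.map Prod.snd).prod : ZMod (p ^ K)) ≠ 0 := by
    refine ⟨(l.map Prod.snd).prod.natAbs, fun h => ?_⟩
    rw [ZMod.intCast_zmod_eq_zero_iff_dvd] at h
    have h2 := Nat.le_of_dvd (Int.natAbs_pos.2 hprod) (Int.natCast_dvd.1 h)
    exact absurd h2 (not_le.2 (Nat.lt_pow_self hp.one_lt))
  have : NeZero (p ^ K) := ⟨pow_ne_zero _ hp.ne_zero⟩
  let R := ZMod (p ^ K)
  have : Finite (Matrix (Fin (l.length + 1)) (Fin (l.length + 1)) R) := by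
    unfold Matrix; infer_instance
  let τ : FreeGroup α →* unitriangularUnits (l.length + 1) R :=
    lift fun i => ⟨syllableUnit R hl i, syllableUnit_mem R hl i⟩
  refine ⟨unitriangularUnits (l.length + 1) R, inferInstance, inferInstance, τ,
    isPGroup_unitriangularUnits hp _ K, fun hτ => ?_⟩
  have hτs : ∀ s : α × ℤ, ((τ (of s.1 ^ s.2)).1 : Matrix _ _ R) =
      1 + (s.2 : R) • syllableMatrix R l s.1 := by
    intro s
    rw [map_zpow, ← coe_syllableUnit_zpow R hl]
    simp [τ]
  -- Each syllable moves at most one column to the right, so column `k` of the top row is reached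
  -- after `k` syllables only by moving every time. The top right corner of the full product is
  -- therefore the product of the exponents.
  have key : ∀ k ≤ l.length, ∀ t : Fin (l.length + 1), k ≤ t →
      ((τ ((l.take k).map fun s => of s.1 ^ s.2).prod).1 :
        Matrix (Fin (l.length + 1)) (Fin (l.length + 1)) R) 0 t =
        if (t : ℕ) = k then (((l.take k).map Prod.snd).prod : R) else 0 := by
    intro k
    induction k with
    | zero =>
      intro _ t _
      rw [List.take_zero, List.map_nil, List.prod_nil, _root_.map_one]
      simp only [OneMemClass.coe_one, Units.val_one, Matrix.one_apply, List.map_nil, List.prod_nil,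
        Int.cast_one]
      refine if_congr ?_ rfl rfl
      rw [Fin.ext_iff]
      exact eq_comm
    | succ k ih =>
      intro hk t ht
      have hk' : k < l.length := hk
      rw [List.take_succ_eq_append_getElem hk', List.map_append, List.prod_append, _root_.map_mul]
      simp only [List.map_cons, List.map_nil, List.prod_cons, List.prod_nil, mul_one,
        Subgroup.coe_mul, Units.val_mul, List.map_append, List.prod_append]
      rw [hτs, mul_add, mul_one, Matrix.add_apply, ih hk'.le t (by omega), if_neg (by omega),
        zero_add, Matrix.mul_smul, Matrix.smul_apply, Matrix.mul_apply]
      split_ifs with h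
      · rw [Finset.sum_eq_single (⟨k, by omega⟩ : Fin (l.length + 1))]
        · rw [ih hk'.le _ le_rfl]
          rw [Int.cast_mul, smul_eq_mul, mul_comm]
          simp [syllableMatrix, h, hk', -Int.cast_list_prod]
        · intro u _ hu
          have : ¬ ((u : ℕ) + 1 = t) := by
            intro h'
            exact hu (Fin.ext (by simp; omega))
          simp [syllableMatrix, this]
        · simp
      · rw [Finset.sum_eq_zero, smul_zero]
        intro u _
        by_cases hu : (u : ℕ) + 1 = t
        · rw [ih hk'.le u (by omega), if_neg (by omega), zero_mul]
        · simp [syllableMatrix, hu]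
  have h1 := key l.length le_rfl (Fin.last _) (by simp)
  rw [List.take_length, hτ] at h1
  simp only [Fin.val_last, if_true, OneMemClass.coe_one, Units.val_one] at h1
  by_cases hr : l.length = 0
  · rw [List.length_eq_zero_iff] at hr
    subst hr
    exact hg (by simp)
  · rw [Matrix.one_apply_ne (by rw [Ne, Fin.ext_iff]; simpa using Ne.symm hr)] at h1
    exact hK (by simpa using h1.symm)

/-! ### Commuting elements and roots in free groups. -/

theorem isCyclic_of_comm (h : ∀ x y : FreeGroup α, x * y = y * x) : IsCyclic (FreeGroup α) := by
  classical
  have hs : Subsingleton α := ⟨fun a b => by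
    by_contra hab
    have h1 := congrArg toWord (h (of a) (of b))
    simp [toWord_mul, reduce.cons, hab, Ne.symm hab] at h1⟩
  rcases isEmpty_or_nonempty α with he | ⟨⟨a⟩⟩
  · infer_instance
  · let : Unique α := ⟨⟨a⟩, fun b => Subsingleton.elim _ _⟩
    infer_instance

/-- The subgroup generated by `x` and `y` is free by Nielsen–Schreier and abelian, hence cyclic. -/
theorem exists_zpow_of_commute {x y : FreeGroup α} (h : Commute x y) :
    ∃ (e : FreeGroup α) (i j : ℤ), x = e ^ i ∧ y = e ^ j := by
  let S := Subgroup.closure {x, y}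
  have hS : ∀ a b : S, a * b = b * a := by
    have : ∀ a ∈ S, ∀ b ∈ S, a * b = b * a := by
      intro a ha b hb
      refine Subgroup.closure_induction₂ (p := fun a b _ _ => Commute a b) ?_ ?_ ?_ ?_ ?_ ?_ ?_ ha hb
      · rintro u v (rfl | rfl) (rfl | rfl)
        exacts [Commute.refl _, h, h.symm, Commute.refl _]
      · exact fun _ _ => Commute.one_left _
      · exact fun _ _ => Commute.one_right _
      · exact fun _ _ _ _ _ _ h1 h2 => h1.mul_left h2
      · exact fun _ _ _ _ _ _ h1 h2 => h1.mul_right h2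
      · exact fun _ _ _ _ h1 => h1.inv_left
      · exact fun _ _ _ _ h1 => h1.inv_right
    exact fun a b => Subtype.ext (this a a.2 b b.2)
  let φ := IsFreeGroup.toFreeGroup S
  have hc : IsCyclic (FreeGroup (IsFreeGroup.Generators S)) := isCyclic_of_comm fun u v => by
    obtain ⟨a, rfl⟩ := φ.surjective u
    obtain ⟨b, rfl⟩ := φ.surjective v
    rw [← _root_.map_mul, hS, _root_.map_mul]
  obtain ⟨⟨e, he⟩⟩ : IsCyclic S := isCyclic_of_surjective φ.symm φ.symm.surjective
  obtain ⟨i, hi⟩ := he ⟨x, Subgroup.subset_closure (by simp)⟩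
  obtain ⟨j, hj⟩ := he ⟨y, Subgroup.subset_closure (by simp)⟩
  exact ⟨e, i, j, by simpa using (congrArg Subtype.val hi).symm,
    by simpa using (congrArg Subtype.val hj).symm⟩

/-- Write `e` as a reduced conjugate of a cyclically reduced word. A nonempty conjugator would
survive at both ends of `e ^ s`; so it is empty, and `e ^ s` is spelled by `s` copies of one word.
-/
theorem dvd_norm_pow [DecidableEq α] {e : FreeGroup α} {s : ℕ}
    (h : IsCyclicallyReduced (e ^ s).toWord) : s ∣ (e ^ s).norm := by
  by_cases hs : s = 0
  · simp [hs]
  have h1 : (e ^ s).toWord = _ :=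
    (toWord_pow e s).trans (reduceCyclically.reduce_flatten_replicate isReduced_toWord s)
  rw [if_neg hs] at h1
  cases hc : reduceCyclically.conjugator e.toWord with
  | nil =>
    rw [hc] at h1
    simp [norm, h1]
  | cons a t =>
    rw [hc] at h1
    have h2 := h.2 (a.1, !a.2) (by
      rw [h1, Option.mem_def, List.getLast?_append]; simp [invRev]) a (by simp [h1]) rfl
    simp at h2

theorem dvd_norm_zpow [DecidableEq α] {e : FreeGroup α} {s : ℤ}
    (h : IsCyclicallyReduced (e ^ s).toWord) : s.natAbs ∣ (e ^ s).norm := by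
  obtain ⟨n, rfl | rfl⟩ := s.eq_nat_or_neg
  · rw [zpow_natCast] at h ⊢
    simpa using dvd_norm_pow h
  · rw [zpow_neg, ← inv_zpow, zpow_natCast] at h ⊢
    simpa using dvd_norm_pow h

/-- If `x` cannot be separated from the cyclic subgroup of `d` in the finite `p`-quotients of a free
group, then some power of `x` with exponent controlled by the length of `d` lies in that subgroup. -/
theorem pow_mem_zpowers_of_forall_map_mem [DecidableEq α] {p : ℕ} (hp : p.Prime)
    {x d : FreeGroup α} (hd : d ≠ 1) (hcyc : IsCyclicallyReduced d.toWord) {n j : ℕ}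
    (hn : d.norm ∣ n * p ^ j)
    (h : ∀ (T : Type) [Group T] [Finite T] (τ : FreeGroup α →* T), IsPGroup p T →
      τ x ∈ Subgroup.zpowers (τ d)) :
    x ^ n ∈ Subgroup.zpowers d := by
  have hcomm : Commute x d := by
    rw [← commutatorElement_eq_one_iff_commute]
    by_contra hne
    obtain ⟨T, _, _, τ, hT, h1⟩ := exists_isPGroup_map_ne_one hp hne
    obtain ⟨k, hk⟩ := h T τ hT
    apply h1
    rw [map_commutatorElement, commutatorElement_eq_one_iff_commute, ← hk]
    exact (Commute.refl _).zpow_left k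
  obtain ⟨e, i, s, rfl, rfl⟩ := exists_zpow_of_commute hcomm
  have hs : s ≠ 0 := by rintro rfl; simp at hd
  have he : e ≠ 1 := by rintro rfl; simp at hd
  have hsn := (dvd_norm_zpow hcyc).trans hn
  -- It suffices that `s = ± p ^ a * r` divides `i * n`: the length bound gives `r ∣ n`, and the
  -- finite `p`-quotients give `p ^ a ∣ i`.
  obtain ⟨a, r, hr, hsr⟩ := Nat.exists_eq_pow_mul_and_not_dvd (Int.natAbs_ne_zero.2 hs) p hp.ne_one
  have hrn : r ∣ n := by
    have h1 : r ∣ n * p ^ j := (Dvd.intro_left _ hsr.symm).trans hsn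
    exact ((Nat.Coprime.pow_left j ((Nat.Prime.coprime_iff_not_dvd hp).2 hr)).symm).dvd_of_dvd_mul_right h1
  have hai : ((p ^ a : ℕ) : ℤ) ∣ i := by
    have h1 : e ^ p ^ a ≠ 1 := by
      intro h2
      exact he ((pow_eq_one_iff_left (pow_ne_zero a hp.ne_zero)).1 h2)
    -- In a `p`-quotient where `e ^ p ^ a` survives, the order of `e` is divisible by `p ^ a`, so
    -- the relation there can be read modulo `p ^ a`.
    obtain ⟨T, _, _, τ, hT, h2⟩ := exists_isPGroup_map_ne_one hp h1
    obtain ⟨b, hb⟩ := (@IsPGroup.iff_orderOf p T _ ⟨hp⟩).1 hT (τ e)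
    have hab : a ≤ b := by
      by_contra hlt
      apply h2
      rw [map_pow, ← orderOf_dvd_iff_pow_eq_one, hb]
      exact pow_dvd_pow p (by omega)
    obtain ⟨k, hk⟩ := h T τ hT
    simp only [map_zpow, ← zpow_mul] at hk
    have h3 : (orderOf (τ e) : ℤ) ∣ i - s * k := by
      rw [orderOf_dvd_iff_zpow_eq_one, zpow_sub, ← hk, mul_inv_cancel]
    have h4 : ((p ^ a : ℕ) : ℤ) ∣ i - s * k := by
      refine dvd_trans ?_ h3
      rw [hb]
      exact_mod_cast pow_dvd_pow p hab
    have h5 : ((p ^ a : ℕ) : ℤ) ∣ s := by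
      rw [Int.natCast_dvd, hsr]
      exact dvd_mul_right _ _
    exact (Int.dvd_iff_dvd_of_dvd_sub h4).2 (h5.mul_right k)
  obtain ⟨u, hu⟩ := hai
  obtain ⟨v, hv⟩ := hrn
  have hin : s ∣ i * n := by
    rw [← Int.natAbs_dvd, hsr, hu, hv]
    exact ⟨u * v, by push_cast; ring⟩
  obtain ⟨w, hw⟩ := hin
  exact ⟨w, by simp only [← zpow_natCast, ← zpow_mul, hw]⟩

end FreeGroup

/-! ### Alternating words and cyclic reduction. -/

section Words

variable {X : Type*} [Group X]

/-- The product `a₁ b₁ a₂ b₂ ⋯` of the entries of a list of pairs `(aᵢ, bᵢ)`. -/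
def pairProd (l : List (X × X)) : X := (l.map fun s => s.1 * s.2).prod

@[simp] theorem pairProd_nil : pairProd ([] : List (X × X)) = 1 := rfl

@[simp] theorem pairProd_cons (s : X × X) (l : List (X × X)) :
    pairProd (s :: l) = s.1 * s.2 * pairProd l := by simp [pairProd]

@[simp] theorem pairProd_append (l m : List (X × X)) :
    pairProd (l ++ m) = pairProd l * pairProd m := by simp [pairProd]

theorem pairProd_flatten_replicate (n : ℕ) (l : List (X × X)) :
    pairProd (List.replicate n l).flatten = pairProd l ^ n := by
  induction n with
  | zero => simp
  | succ n ih => rw [List.replicate_succ, List.flatten_cons, pairProd_append, ih, pow_succ']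

theorem map_pairProd {Z : Type*} [Group Z] (f : X →* Z) (l : List (X × X)) :
    f (pairProd l) = pairProd (l.map (Prod.map f f)) := by
  induction l with
  | nil => simp
  | cons s l ih => simp [ih]

/-- No entry of the word `a₁ b₁ a₂ b₂ ⋯`, except possibly `a₁`, lies in `U`. -/
def IsAlternating (U : Subgroup X) (l : List (X × X)) : Prop :=
  (∀ s ∈ l, s.2 ∉ U) ∧ l.IsChain fun _ t => t.1 ∉ U

theorem isAlternating_cons {U : Subgroup X} {s : X × X} {l : List (X × X)} :
    IsAlternating U (s :: l) ↔ s.2 ∉ U ∧ (∀ t ∈ l.head?, t.1 ∉ U) ∧ IsAlternating U l := by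
  simp only [IsAlternating, List.isChain_cons, List.forall_mem_cons]
  tauto

theorem IsAlternating.of_forall {U : Subgroup X} {l : List (X × X)}
    (h : ∀ s ∈ l, s.1 ∉ U ∧ s.2 ∉ U) : IsAlternating U l := by
  refine ⟨fun s hs => (h s hs).2, List.isChain_iff_getElem.2 fun i hi => ?_⟩
  exact (h _ (List.getElem_mem _)).1

theorem IsAlternating.map {Z : Type*} [Group Z] {U : Subgroup X} {V : Subgroup Z} (f : X →* Z)
    {l : List (X × X)} (hl : IsAlternating U l)
    (h : ∀ s ∈ l, (s.1 ∉ U → f s.1 ∉ V) ∧ (s.2 ∉ U → f s.2 ∉ V)) :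
    IsAlternating V (l.map (Prod.map f f)) := by
  induction l with
  | nil => exact ⟨by simp, by simp⟩
  | cons s l ih =>
    rw [isAlternating_cons] at hl
    rw [List.map_cons, isAlternating_cons]
    refine ⟨(h s (by simp)).2 hl.1, ?_, ih hl.2.2 fun t ht => h t (by simp [ht])⟩
    intro t ht
    cases l with
    | nil => simp at ht
    | cons r l =>
      simp only [List.map_cons, List.head?_cons, Option.mem_def, Option.some.injEq] at ht
      subst ht
      exact (h r (by simp)).1 (hl.2.1 r (by simp))

/-- Existence of normal forms in a group generated by two subgroups. -/
theorem exists_isAlternating {P Q U : Subgroup X} (hP : U ≤ P) (hQ : U ≤ Q) {g : X}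
    (hg : g ∈ P ⊔ Q) : ∃ (l : List (X × X)) (a : X), (∀ s ∈ l, s.1 ∈ P ∧ s.2 ∈ Q) ∧
      IsAlternating U l ∧ a ∈ P ∧ g = pairProd l * a := by
  have mulP : ∀ x ∈ P, ∀ (l : List (X × X)) (a : X), (∀ s ∈ l, s.1 ∈ P ∧ s.2 ∈ Q) →
      IsAlternating U l → a ∈ P → ∃ (l' : List (X × X)) (a' : X), (∀ s ∈ l', s.1 ∈ P ∧ s.2 ∈ Q) ∧
      IsAlternating U l' ∧ a' ∈ P ∧ x * (pairProd l * a) = pairProd l' * a' := by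
    intro x hx l a hl ha haP
    cases l with
    | nil => exact ⟨[], x * a, hl, ha, mul_mem hx haP, by simp⟩
    | cons s l =>
      refine ⟨(x * s.1, s.2) :: l, a, ?_, ?_, haP, by simp [mul_assoc]⟩
      · rw [List.forall_mem_cons] at hl ⊢
        exact ⟨⟨mul_mem hx hl.1.1, hl.1.2⟩, hl.2⟩
      · rw [isAlternating_cons] at ha ⊢
        exact ha
  have mulQ : ∀ x ∈ Q, ∀ (l : List (X × X)) (a : X), (∀ s ∈ l, s.1 ∈ P ∧ s.2 ∈ Q) →
      IsAlternating U l → a ∈ P → ∃ (l' : List (X × X)) (a' : X), (∀ s ∈ l', s.1 ∈ P ∧ s.2 ∈ Q) ∧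
      IsAlternating U l' ∧ a' ∈ P ∧ x * (pairProd l * a) = pairProd l' * a' := by
    intro x hx l a hl ha haP
    by_cases hxU : x ∈ U
    · exact mulP x (hP hxU) l a hl ha haP
    cases l with
    | nil =>
      refine ⟨[(1, x)], a, by simpa using hx, ?_, haP, by simp⟩
      exact isAlternating_cons.2 ⟨hxU, by simp, ha⟩
    | cons s l =>
      rw [List.forall_mem_cons] at hl
      by_cases hs : s.1 ∈ U
      · have hb : x * s.1 * s.2 ∈ Q := mul_mem (mul_mem hx (hQ hs)) hl.1.2
        rw [isAlternating_cons] at ha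
        by_cases hb' : x * s.1 * s.2 ∈ U
        · obtain ⟨l', a', h1, h2, h3, h4⟩ := mulP _ (hP hb') l a hl.2 ha.2.2 haP
          exact ⟨l', a', h1, h2, h3, by rw [← h4]; simp [mul_assoc]⟩
        · refine ⟨(1, x * s.1 * s.2) :: l, a, ?_, ?_, haP, by simp [mul_assoc]⟩
          · exact List.forall_mem_cons.2 ⟨⟨P.one_mem, hb⟩, hl.2⟩
          · exact isAlternating_cons.2 ⟨hb', ha.2⟩
      · refine ⟨(1, x) :: s :: l, a, ?_, ?_, haP, by simp [mul_assoc]⟩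
        · exact List.forall_mem_cons.2 ⟨⟨P.one_mem, hx⟩, List.forall_mem_cons.2 hl⟩
        · exact isAlternating_cons.2 ⟨hxU, by simpa using hs, ha⟩
  rw [Subgroup.sup_eq_closure] at hg
  induction hg using Subgroup.closure_induction_left with
  | one => exact ⟨[], 1, by simp, ⟨by simp, by simp⟩, P.one_mem, by simp⟩
  | mul_left x hx y _ ih =>
    obtain ⟨l, a, h1, h2, h3, rfl⟩ := ih
    rcases hx with hx | hx
    · exact mulP x hx l a h1 h2 h3
    · exact mulQ x hx l a h1 h2 h3
  | inv_mul_cancel x hx y _ ih =>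
    obtain ⟨l, a, h1, h2, h3, rfl⟩ := ih
    rcases hx with hx | hx
    · exact mulP _ (inv_mem hx) l a h1 h2 h3
    · exact mulQ _ (inv_mem hx) l a h1 h2 h3

/-- An element that is not conjugate into `P` or `Q` is conjugate to a cyclically reduced word. -/
theorem exists_isConj_pairProd {P Q U : Subgroup X} (hP : U ≤ P) (hQ : U ≤ Q) (hPQ : P ⊔ Q = ⊤)
    {c : X} (hcP : ∀ x ∈ P, ¬ IsConj c x) (hcQ : ∀ x ∈ Q, ¬ IsConj c x) :
    ∃ l : List (X × X), l ≠ [] ∧ (∀ s ∈ l, s.1 ∈ P ∧ s.2 ∈ Q) ∧ (∀ s ∈ l, s.1 ∉ U ∧ s.2 ∉ U) ∧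
      IsConj c (pairProd l) := by
  have key : ∀ (n : ℕ) (l : List (X × X)) (a : X), l.length = n → (∀ s ∈ l, s.1 ∈ P ∧ s.2 ∈ Q) →
      IsAlternating U l → a ∈ P → IsConj c (pairProd l * a) →
      ∃ l : List (X × X), l ≠ [] ∧ (∀ s ∈ l, s.1 ∈ P ∧ s.2 ∈ Q) ∧ (∀ s ∈ l, s.1 ∉ U ∧ s.2 ∉ U) ∧
      IsConj c (pairProd l) := by
    intro n
    induction n using Nat.strong_induction_on with
    | _ n ih =>
    intro l a hn hl halt ha hc
    cases l with
    | nil => exact absurd hc (hcP _ (by simpa using ha))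
    | cons s t =>
      -- Conjugation moves the trailing factor `a` to the front. If `a * s.1` falls into `U`, it
      -- merges with its `Q`-neighbours across the cyclic seam and the list gets shorter; otherwise
      -- the word is cyclically reduced.
      have hc1 : IsConj c (a * s.1 * s.2 * pairProd t) := by
        refine hc.trans (isConj_iff.2 ⟨a, ?_⟩)
        simp [mul_assoc]
      rw [List.forall_mem_cons] at hl
      have halt' := halt
      rw [isAlternating_cons] at halt
      by_cases hs : a * s.1 ∈ U
      · rcases List.eq_nil_or_concat' t with rfl | ⟨t', r, rfl⟩
        · exact absurd hc1 (hcQ _ (by simpa using mul_mem (hQ hs) hl.1.2))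
        · simp only [List.forall_mem_append, List.forall_mem_singleton] at hl
          have hc2 : IsConj c (pairProd t' * (r.1 * (r.2 * (a * s.1 * s.2)))) := by
            refine hc1.trans (isConj_iff.2 ⟨(a * s.1 * s.2)⁻¹, ?_⟩)
            simp [mul_assoc]
          have hq : r.2 * (a * s.1 * s.2) ∈ Q :=
            mul_mem hl.2.2.2 (mul_mem (hQ hs) hl.1.2)
          have hch := halt.2.2.2
          rw [List.isChain_append] at hch
          have ht' : ∀ s ∈ t', s.2 ∉ U := fun s hs => halt.2.2.1 s (by simp [hs])
          by_cases hqU : r.2 * (a * s.1 * s.2) ∈ U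
          · exact ih t'.length (by simp at hn; omega) t' _ rfl hl.2.1 ⟨ht', hch.1⟩
              (mul_mem hl.2.2.1 (hP hqU)) hc2
          · refine ih (t'.length + 1) (by simp at hn; omega)
              (t' ++ [(r.1, r.2 * (a * s.1 * s.2))]) 1 (by simp) ?_ ⟨?_, ?_⟩ P.one_mem ?_
            · simp only [List.forall_mem_append, List.forall_mem_singleton]
              exact ⟨hl.2.1, hl.2.2.1, hq⟩
            · simp only [List.forall_mem_append, List.forall_mem_singleton]
              exact ⟨ht', hqU⟩
            · rw [List.isChain_append]
              refine ⟨hch.1, by simp, fun x hx y hy => ?_⟩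
              simp only [List.head?_cons, Option.mem_def, Option.some.injEq] at hy
              subst hy
              exact hch.2.2 x hx r (by simp)
            · simpa using hc2
      · refine ⟨(a * s.1, s.2) :: t, by simp, ?_, ?_, by simpa using hc1⟩
        · exact List.forall_mem_cons.2 ⟨⟨mul_mem ha hl.1.1, hl.1.2⟩, hl.2⟩
        · refine List.forall_mem_cons.2 ⟨⟨hs, halt.1⟩, fun r hr => ⟨?_, halt.2.2.1 r hr⟩⟩
          have h1 : ∀ (t : List (X × X)) (s : X × X), (s :: t).IsChain (fun _ t => t.1 ∉ U) →
              ∀ r ∈ t, r.1 ∉ U := by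
            intro t
            induction t with
            | nil => simp
            | cons q t ih =>
              intro s hs
              rw [List.isChain_cons_cons] at hs
              exact List.forall_mem_cons.2 ⟨hs.1, ih q hs.2⟩
          exact h1 t s halt'.2 r hr
  obtain ⟨l, a, h1, h2, h3, h4⟩ :=
    exists_isAlternating hP hQ (g := c) (hPQ ▸ Subgroup.mem_top c)
  exact key l.length l a rfl h1 h2 h3 (h4 ▸ IsConj.refl c)

end Words

/-! ### Labels of paths in the coset graph. -/

section Labels

variable {Y : Type*} [Group Y]

/-- The word in the free group on `Y ⧸ U` read along the path that starts at `x` and is described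
by the list `l`. -/
def labelWord (U : Subgroup Y) : Y → List (Y × Y) → List ((Y ⧸ U) × Bool)
  | _, [] => []
  | x, s :: l => (((s.1⁻¹ * x)⁻¹ : Y), true) :: (((s.2⁻¹ * (s.1⁻¹ * x))⁻¹ : Y), false) ::
      labelWord U (s.2⁻¹ * (s.1⁻¹ * x)) l

variable {U : Subgroup Y}

@[simp] theorem length_labelWord (x : Y) (l : List (Y × Y)) :
    (labelWord U x l).length = 2 * l.length := by
  induction l generalizing x with
  | nil => rfl
  | cons s l ih => simp [labelWord, ih]; ring

theorem labelWord_append (x : Y) (l m : List (Y × Y)) :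
    labelWord U x (l ++ m) = labelWord U x l ++ labelWord U ((pairProd l)⁻¹ * x) m := by
  induction l generalizing x with
  | nil => simp [labelWord]
  | cons s l ih => simp [labelWord, ih, mul_assoc]

/-- The two edges coming from a second entry cancel only if that entry lies in `U`, and the edges on
either side of a first entry cancel only if that one does. First entries merely move the base point,
so the very first is unrestricted. -/
theorem IsAlternating.isReduced_labelWord {l : List (Y × Y)} (hl : IsAlternating U l) (x : Y) :
    FreeGroup.IsReduced (labelWord U x l) := by
  induction l generalizing x with
  | nil => simp [labelWord]
  | cons s l ih =>
    rw [isAlternating_cons] at hl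
    rw [labelWord, FreeGroup.isReduced_cons_cons]
    refine ⟨fun h => absurd ?_ hl.1, ?_⟩
    · have h1 := QuotientGroup.eq.1 h
      simpa [mul_assoc] using h1
    · cases l with
      | nil => simp [labelWord]
      | cons t l =>
        have h2 := ih hl.2.2 (s.2⁻¹ * (s.1⁻¹ * x))
        rw [labelWord, FreeGroup.isReduced_cons_cons]
        rw [labelWord] at h2
        refine ⟨fun h => absurd ?_ (hl.2.1 t (by simp)), h2⟩
        have h1 := QuotientGroup.eq.1 h
        simpa [mul_assoc] using h1

end Labels

/-! ### Wreath products with a free group. -/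

namespace RegularWreathProduct

variable {D E Y : Type*} [Group D] [Group E] [Group Y]

/-- The homomorphism of wreath products induced by a homomorphism of the base groups. -/
def mapBase (τ : D →* E) : D ≀ᵣ Y →* E ≀ᵣ Y where
  toFun w := ⟨fun y => τ (w.left y), w.right⟩
  map_one' := by ext <;> simp
  map_mul' _ _ := by ext <;> simp

@[simp] theorem mapBase_left (τ : D →* E) (w : D ≀ᵣ Y) (y : Y) :
    (mapBase τ w).left y = τ (w.left y) := rfl

@[simp] theorem mapBase_right (τ : D →* E) (w : D ≀ᵣ Y) : (mapBase τ w).right = w.right := rfl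

theorem isPGroup {p : ℕ} [Finite D] [Finite Y] (hp : p.Prime) (hD : IsPGroup p D)
    (hY : IsPGroup p Y) : IsPGroup p (D ≀ᵣ Y) := by
  have : Fact p.Prime := ⟨hp⟩
  obtain ⟨i, hi⟩ := IsPGroup.iff_card.1 hD
  obtain ⟨j, hj⟩ := IsPGroup.iff_card.1 hY
  refine IsPGroup.of_card (n := i * Nat.card Y + j) ?_
  rw [card, hi, pow_add, ← pow_mul, ← hj]

/-- The homomorphism from the base group of a wreath product to its coordinate at `y`. -/
def coord (D : Type*) {Y : Type*} [Group D] [Group Y] (y : Y) :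
    (rightHom : D ≀ᵣ Y →* Y).ker →* D where
  toFun w := w.1.left y
  map_one' := rfl
  map_mul' a b := by
    have h : a.1.right = 1 := a.2
    simp [h]

theorem left_zpow {w : D ≀ᵣ Y} (hw : w.right = 1) (y : Y) (i : ℤ) :
    (w ^ i).left y = w.left y ^ i :=
  map_zpow (coord D y) ⟨w, hw⟩ i

/-- The element of the base group whose coordinates are the generators of the free group. -/
def edge (U : Subgroup Y) : FreeGroup (Y ⧸ U) ≀ᵣ Y :=
  ⟨fun y => FreeGroup.of ((y⁻¹ : Y) : Y ⧸ U), 1⟩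

theorem conj_edge_left (U : Subgroup Y) (b y : Y) :
    (edge U * inl b * (edge U)⁻¹).left y =
      FreeGroup.of ((y⁻¹ : Y) : Y ⧸ U) * (FreeGroup.of (((b⁻¹ * y)⁻¹ : Y) : Y ⧸ U))⁻¹ := by
  simp [edge]

/-- The coordinate of `edge U` at `y` depends only on the coset of `y⁻¹`, which translation by an
element of `U` preserves. -/
theorem conj_edge_of_mem {U : Subgroup Y} {b : Y} (hb : b ∈ U) :
    edge U * inl b * (edge U)⁻¹ = inl b := by
  ext y
  · rw [conj_edge_left, mul_inv_eq_one.2]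
    · simp
    · congr 1
      rw [QuotientGroup.eq]
      simpa using hb
  · simp [edge]

/-- The coordinates of a product of elements of the complement and of its conjugate by `edge U`. -/
theorem left_pairProd_mul {U : Subgroup Y} {l : List ((FreeGroup (Y ⧸ U) ≀ᵣ Y) × _)}
    (h : ∀ s ∈ l, s.1 = inl s.1.right ∧ s.2 = edge U * inl s.2.right * (edge U)⁻¹)
    {a : FreeGroup (Y ⧸ U) ≀ᵣ Y} (ha : a = inl a.right) (y : Y) :
    (pairProd l * a).left y =
      FreeGroup.mk (labelWord U y (l.map (Prod.map rightHom rightHom))) := by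
  induction l generalizing y with
  | nil => rw [ha]; rfl
  | cons s l ih =>
    rw [List.forall_mem_cons] at h
    have h1 : s.1.left = 1 := by rw [h.1.1]; rfl
    have h2 : s.2.left (s.1.right⁻¹ * y) = _ :=
      (congrArg (fun w : FreeGroup (Y ⧸ U) ≀ᵣ Y => w.left (s.1.right⁻¹ * y)) h.1.2).trans
        (conj_edge_left U _ _)
    have h3 := ih h.2 (s.2.right⁻¹ * (s.1.right⁻¹ * y))
    rw [pairProd_cons, mul_assoc, mul_assoc, mul_left, mul_left, h1, one_mul]
    simp only [Pi.mul_apply]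
    rw [h2, h3, List.map_cons, labelWord, FreeGroup.of, FreeGroup.of, FreeGroup.inv_mk,
      FreeGroup.mul_mk, FreeGroup.mul_mk]
    rfl

end RegularWreathProduct

/-! ### Amalgams, separation along a filter, and `p`-index quotients. -/

/-- The group `G` is the free product of its subgroups `A` and `B` with the common subgroup `U`
amalgamated. -/
structure IsAmalgam {G : Type u} [Group G] (A B U : Subgroup G) : Prop where
  le_left : U ≤ A
  le_right : U ≤ B
  sup_eq_top : A ⊔ B = ⊤
  -- Only pairs of homomorphisms defined on all of `G` are glued: this part of the universal
  -- property suffices, since both embeddings used below factor through a quotient of `G`.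
  exists_hom : ∀ (W : Type u) [Group W] (f g : G →* W), (∀ x ∈ U, f x = g x) →
    ∃ θ : G →* W, (∀ a ∈ A, θ a = f a) ∧ ∀ b ∈ B, θ b = g b

/-- The elements of `A` outside `D` stay outside `D` modulo the subgroups `N` that are small with
respect to the filter `F`. -/
def SeparatedAlong {G : Type u} [Group G] (F : Filter (Subgroup G)) (A D : Subgroup G) : Prop :=
  ∀ a ∈ A, a ∉ D → ∀ᶠ N in F, a ∉ D ⊔ N

theorem PSeparable.of_forall {p : ℕ} {X : Type u} [Group X] {Y : Subgroup X}
    (h : ∀ g ∉ Y, ∃ (P : Type u) (_ : Group P) (_ : Finite P) (ψ : X →* P),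
      IsPGroup p P ∧ ψ g ∉ Y.map ψ) : PSeparable p Y := by
  intro g hg
  obtain ⟨P, _, _, ψ, hP, h1⟩ := h g hg
  refine ⟨ψ.range, inferInstance, inferInstance, ψ.rangeRestrict, hP.to_subgroup _,
    ψ.rangeRestrict_surjective, ?_⟩
  rintro ⟨y, hy, h2⟩
  exact h1 ⟨y, hy, congrArg Subtype.val h2⟩

theorem NormalOfPIndex.isPGroup {p : ℕ} {X : Type u} [Group X] {N : Subgroup X} [N.Normal]
    (h : NormalOfPIndex p N) : IsPGroup p (X ⧸ N) := by
  obtain ⟨k, hk⟩ := h.2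
  exact IsPGroup.of_card (n := k) hk

theorem NormalOfPIndex.finite {p : ℕ} (hp : p.Prime) {X : Type u} [Group X] {N : Subgroup X}
    (h : NormalOfPIndex p N) : Finite (X ⧸ N) := by
  obtain ⟨k, hk⟩ := h.2
  have : N.FiniteIndex := ⟨by rw [hk]; exact pow_ne_zero k hp.ne_zero⟩
  infer_instance

theorem mk_mem_map_mk_iff {X : Type u} [Group X] {D N : Subgroup X} [N.Normal] {x : X} :
    (x : X ⧸ N) ∈ D.map (QuotientGroup.mk' N) ↔ x ∈ D ⊔ N := by
  have h := Subgroup.comap_map_eq (QuotientGroup.mk' N) D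
  rw [QuotientGroup.ker_mk'] at h
  rw [← h]
  rfl

theorem PPrimeIsolated.mem_of_pow_mem {p : ℕ} {X : Type u} [Group X] {Y : Subgroup X}
    (h : PPrimeIsolated p Y) {n : ℕ} (hn0 : n ≠ 0) (hn : ¬ p ∣ n) {g : X} (hg : g ^ n ∈ Y) :
    g ∈ Y := by
  induction n using Nat.recOnMul generalizing g with
  | zero => exact absurd rfl hn0
  | one => simpa using hg
  | prime q hq => exact h g q hq (by rintro rfl; exact hn dvd_rfl) hg
  | mul a b iha ihb =>
    rw [pow_mul] at hg
    refine iha (left_ne_zero_of_mul hn0) (fun h => hn (h.mul_right b)) ?_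
    exact ihb (right_ne_zero_of_mul hn0) (fun h => hn (h.mul_left a)) hg

/-! ### The label homomorphism and separability of the factors. -/

namespace IsAmalgam

open RegularWreathProduct QuotientGroup
open scoped commutatorElement

variable {G : Type u} [Group G] {A B U : Subgroup G}

theorem symm (h : IsAmalgam A B U) : IsAmalgam B A U where
  le_left := h.le_right
  le_right := h.le_left
  sup_eq_top := by rw [sup_comm, h.sup_eq_top]
  exists_hom W _ f g hfg := by
    obtain ⟨θ, h1, h2⟩ := h.exists_hom W g f fun x hx => (hfg x hx).symm
    exact ⟨θ, h2, h1⟩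

theorem hom_ext (h : IsAmalgam A B U) {W : Type*} [Group W] {f g : G →* W}
    (hA : ∀ a ∈ A, f a = g a) (hB : ∀ b ∈ B, f b = g b) : f = g := by
  have h1 : A ⊔ B ≤ f.eqLocus g := sup_le hA hB
  ext x
  exact h1 (h.sup_eq_top ▸ Subgroup.mem_top x)

theorem exists_labelHom (h : IsAmalgam A B U) (N : Subgroup G) [N.Normal] :
    ∃ θ : G →* FreeGroup ((G ⧸ N) ⧸ U.map (mk' N)) ≀ᵣ (G ⧸ N),
    (∀ a ∈ A, θ a = inl (a : G ⧸ N)) ∧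
      ∀ b ∈ B, θ b = edge (U.map (mk' N)) * inl (b : G ⧸ N) * (edge (U.map (mk' N)))⁻¹ := by
  refine h.exists_hom _ (inl.comp (mk' N))
    ((MulAut.conj (edge (U.map (mk' N)))).toMonoidHom.comp (inl.comp (mk' N))) fun x hx => ?_
  exact (conj_edge_of_mem (Subgroup.mem_map_of_mem (mk' N) hx)).symm

section LabelHom

variable (h : IsAmalgam A B U) (N : Subgroup G) [N.Normal]

/-- The homomorphism of an amalgamated product to a wreath product of a free group with the
quotient by `N`. It records the edges of the graph of cosets that a word passes. -/
noncomputable def labelHom : G →* FreeGroup ((G ⧸ N) ⧸ U.map (mk' N)) ≀ᵣ (G ⧸ N) :=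
  (h.exists_labelHom N).choose

theorem labelHom_of_mem_left {a : G} (ha : a ∈ A) : h.labelHom N a = inl (a : G ⧸ N) :=
  (h.exists_labelHom N).choose_spec.1 a ha

theorem labelHom_of_mem_right {b : G} (hb : b ∈ B) : h.labelHom N b =
    edge (U.map (mk' N)) * inl (b : G ⧸ N) * (edge (U.map (mk' N)))⁻¹ :=
  (h.exists_labelHom N).choose_spec.2 b hb

@[simp] theorem labelHom_right (x : G) : (h.labelHom N x).right = (x : G ⧸ N) := by
  have h1 : rightHom.comp (h.labelHom N) = mk' N := by
    refine h.hom_ext (fun a ha => ?_) fun b hb => ?_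
    · simp [h.labelHom_of_mem_left N ha]
    · simp [h.labelHom_of_mem_right N hb, edge]
  exact DFunLike.congr_fun h1 x

theorem labelHom_letters {l : List (G × G)} (hl : ∀ s ∈ l, s.1 ∈ A ∧ s.2 ∈ B) :
    ∀ s ∈ l.map (Prod.map (h.labelHom N) (h.labelHom N)), s.1 = inl s.1.right ∧
      s.2 = edge (U.map (mk' N)) * inl s.2.right * (edge (U.map (mk' N)))⁻¹ := by
  intro s hs
  obtain ⟨t, ht, rfl⟩ := List.mem_map.1 hs
  simp only [Prod.map_fst, Prod.map_snd, labelHom_right]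
  exact ⟨h.labelHom_of_mem_left N (hl t ht).1, h.labelHom_of_mem_right N (hl t ht).2⟩

theorem labelHom_pairProd_left {l : List (G × G)} (hl : ∀ s ∈ l, s.1 ∈ A ∧ s.2 ∈ B) {a : G}
    (ha : a ∈ A) (y : G ⧸ N) : (h.labelHom N (pairProd l * a)).left y =
      FreeGroup.mk (labelWord (U.map (mk' N)) y (l.map (Prod.map (mk' N) (mk' N)))) := by
  rw [map_mul, map_pairProd, left_pairProd_mul (h.labelHom_letters N hl)
    (by simpa using h.labelHom_of_mem_left N ha), List.map_map]
  congr 2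
  refine List.map_congr_left fun s _ => ?_
  exact Prod.ext (h.labelHom_right N s.1) (h.labelHom_right N s.2)

/-- On `N`, the homomorphism `labelHom` is determined by one coordinate. -/
theorem labelHom_eq_one {x : G} (hx : x ∈ N) (h1 : (h.labelHom N x).left 1 = 1) :
    h.labelHom N x = 1 := by
  classical
  -- The normal form is taken in the image: letters of `G` outside `U` may fall into `U` modulo `N`,
  -- whereas letters of the image outside the image of `U` remain so after projection to `G ⧸ N`.
  obtain ⟨l, w, hl, halt, ⟨a, ha, rfl⟩, hw⟩ := exists_isAlternating
    (P := A.map (h.labelHom N)) (Q := B.map (h.labelHom N)) (U := U.map (h.labelHom N))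
    (Subgroup.map_mono h.le_left) (Subgroup.map_mono h.le_right) (g := h.labelHom N x)
    (by rw [← Subgroup.map_sup, h.sup_eq_top]; exact ⟨x, Subgroup.mem_top x, rfl⟩)
  have hlet : ∀ s ∈ l, s.1 = inl s.1.right ∧
      s.2 = edge (U.map (mk' N)) * inl s.2.right * (edge (U.map (mk' N)))⁻¹ := by
    intro s hs
    obtain ⟨⟨b, hb, h2⟩, c, hc, h3⟩ := hl s hs
    rw [← h2, ← h3]
    simp only [labelHom_right]
    exact ⟨h.labelHom_of_mem_left N hb, h.labelHom_of_mem_right N hc⟩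
  have hlab := left_pairProd_mul hlet (a := h.labelHom N a)
    (by simpa using h.labelHom_of_mem_left N ha) 1
  have halt' : IsAlternating (U.map (mk' N)) (l.map (Prod.map rightHom rightHom)) := by
    refine halt.map _ fun s hs => ⟨fun hs1 => ?_, fun hs2 => ?_⟩
    · rintro ⟨v, hv, h4⟩
      apply hs1
      refine ⟨v, hv, ?_⟩
      rw [h.labelHom_of_mem_left N (h.le_left hv), (hlet s hs).1]
      exact congrArg inl h4
    · rintro ⟨v, hv, h4⟩
      apply hs2
      refine ⟨v, hv, ?_⟩
      rw [h.labelHom_of_mem_right N (h.le_right hv), (hlet s hs).2]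
      exact congrArg (fun z => edge (U.map (mk' N)) * inl z * (edge (U.map (mk' N)))⁻¹) h4
  rw [← hw, h1] at hlab
  have h5 := congrArg FreeGroup.toWord hlab
  rw [FreeGroup.toWord_one, FreeGroup.toWord_mk, (halt'.isReduced_labelWord 1).reduce_eq] at h5
  have h6 := congrArg List.length h5
  have h7 : l = [] := by simpa using h6
  subst h7
  rw [pairProd_nil, one_mul] at hw
  have h8 : (x : G ⧸ N) = a := by
    simpa using congrArg RegularWreathProduct.right hw
  rw [hw, h.labelHom_of_mem_left N ha, ← h8, (QuotientGroup.eq_one_iff x).2 hx, map_one]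

end LabelHom

/-- Elements outside the first factor have nontrivial labels modulo small subgroups. -/
theorem eventually_labelHom_left_ne_one (h : IsAmalgam A B U) {F : Filter (Subgroup G)}
    (hA : SeparatedAlong F A U) (hB : SeparatedAlong F B U) {g : G} (hg : g ∉ A) :
    ∀ᶠ N : Subgroup G in F, ∀ [N.Normal], (h.labelHom N g).left 1 ≠ 1 := by
  classical
  obtain ⟨l, a, hl, halt, ha, rfl⟩ := exists_isAlternating h.le_left h.le_right (g := g)
    (h.sup_eq_top ▸ Subgroup.mem_top g)
  have hev : ∀ᶠ N in F, ∀ s ∈ l, (s.1 ∉ U → s.1 ∉ U ⊔ N) ∧ (s.2 ∉ U → s.2 ∉ U ⊔ N) := by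
    have h1 : ∀ s ∈ {s | s ∈ l}, ∀ᶠ N in F,
        (s.1 ∉ U → s.1 ∉ U ⊔ N) ∧ (s.2 ∉ U → s.2 ∉ U ⊔ N) := fun s hs =>
      (Filter.eventually_imp_distrib_left.2 (hA s.1 (hl s hs).1)).and
        (Filter.eventually_imp_distrib_left.2 (hB s.2 (hl s hs).2))
    exact (Filter.eventually_all_finite l.finite_toSet).2 h1
  filter_upwards [hev] with N hN _ h1
  have halt' : IsAlternating (U.map (mk' N)) (l.map (Prod.map (mk' N) (mk' N))) := by
    refine halt.map _ fun s hs => ⟨fun hs1 => ?_, fun hs1 => ?_⟩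
    · exact fun hm => (hN s hs).1 hs1 (mk_mem_map_mk_iff.1 hm)
    · exact fun hm => (hN s hs).2 hs1 (mk_mem_map_mk_iff.1 hm)
  rw [h.labelHom_pairProd_left N hl ha] at h1
  have h5 := congrArg FreeGroup.toWord h1
  rw [FreeGroup.toWord_one, FreeGroup.toWord_mk, (halt'.isReduced_labelWord 1).reduce_eq] at h5
  have h6 := congrArg List.length h5
  have h7 : l = [] := by simpa using h6
  subst h7
  exact hg (by simpa using ha)

theorem eventually_labelHom_ne_one (h : IsAmalgam A B U) {F : Filter (Subgroup G)}
    (hA : SeparatedAlong F A U) (hB : SeparatedAlong F B U) (hA' : SeparatedAlong F A ⊥) {g : G}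
    (hg : g ≠ 1) : ∀ᶠ N : Subgroup G in F, ∀ [N.Normal], h.labelHom N g ≠ 1 := by
  by_cases hgA : g ∈ A
  · filter_upwards [hA' g hgA (by simpa using hg)] with N hN _ h1
    rw [bot_sup_eq] at hN
    apply hN
    rw [← QuotientGroup.eq_one_iff, ← h.labelHom_right N, h1, one_right]
  · filter_upwards [h.eventually_labelHom_left_ne_one hA hB hgA] with N hN _ h1
    exact hN (by rw [h1]; rfl)

/-- The factors of the amalgamated product are `p`-separable. -/
theorem pSeparable_left (h : IsAmalgam A B U) {p : ℕ} (hp : p.Prime) {F : Filter (Subgroup G)}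
    [F.NeBot] (hF : ∀ᶠ N in F, NormalOfPIndex p N) (hA : SeparatedAlong F A U)
    (hB : SeparatedAlong F B U) : PSeparable p A := by
  refine PSeparable.of_forall fun g hg => ?_
  obtain ⟨N, hN, h1⟩ := (hF.and (h.eventually_labelHom_left_ne_one hA hB hg)).exists
  have : N.Normal := hN.1
  have : Finite (G ⧸ N) := hN.finite hp
  obtain ⟨T, _, _, τ, hT, h2⟩ := FreeGroup.exists_isPGroup_map_ne_one hp h1
  refine ⟨T ≀ᵣ (G ⧸ N), inferInstance, inferInstance, (mapBase τ).comp (h.labelHom N),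
    RegularWreathProduct.isPGroup hp hT hN.isPGroup, ?_⟩
  rintro ⟨a, ha, h3⟩
  have h4 := congrArg (fun w : T ≀ᵣ (G ⧸ N) => w.left 1) h3
  simp only [MonoidHom.comp_apply, mapBase_left, h.labelHom_of_mem_left N ha, left_inl,
    Pi.one_apply, map_one] at h4
  exact h2 h4.symm

/-- Elements of `A` are separated from `D` in some `G ⧸ N`; all others are already separated from
`A`. -/
theorem pSeparable_of_le_left (h : IsAmalgam A B U) {p : ℕ} (hp : p.Prime)
    {F : Filter (Subgroup G)} [F.NeBot] (hF : ∀ᶠ N in F, NormalOfPIndex p N)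
    (hA : SeparatedAlong F A U) (hB : SeparatedAlong F B U) {D : Subgroup G} (hDA : D ≤ A)
    (hD : SeparatedAlong F A D) : PSeparable p D := by
  refine PSeparable.of_forall fun g hg => ?_
  by_cases hgA : g ∈ A
  · obtain ⟨N, hN, h1⟩ := (hF.and (hD g hgA hg)).exists
    have : N.Normal := hN.1
    exact ⟨G ⧸ N, inferInstance, hN.finite hp, mk' N, hN.isPGroup,
      fun hm => h1 (mk_mem_map_mk_iff.1 hm)⟩
  · obtain ⟨P, i, j, ψ, hP, -, h1⟩ := h.pSeparable_left hp hF hA hB g hgA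
    exact ⟨P, i, j, ψ, hP, fun hm => h1 (Subgroup.map_mono hDA hm)⟩

/-! ### Cyclically reduced words. -/

section Hyperbolic

variable (h : IsAmalgam A B U) {N : Subgroup G} [N.Normal] {l : List (G × G)}

theorem isReduced_pow (hl : ∀ s ∈ l, s.1 ∉ U ⊔ N ∧ s.2 ∉ U ⊔ N) (n : ℕ) (y : G ⧸ N) :
    FreeGroup.IsReduced (labelWord (U.map (mk' N)) y
      ((List.replicate n l).flatten.map (Prod.map (mk' N) (mk' N)))) := by
  refine (IsAlternating.of_forall fun s hs => ?_).isReduced_labelWord y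
  obtain ⟨t, ht, rfl⟩ := List.mem_map.1 hs
  obtain ⟨l', hl', ht'⟩ := List.mem_flatten.1 ht
  obtain rfl := List.eq_of_mem_replicate hl'
  exact ⟨fun hm => (hl t ht').1 (mk_mem_map_mk_iff.1 hm),
    fun hm => (hl t ht').2 (mk_mem_map_mk_iff.1 hm)⟩

theorem toWord_labelHom_pow [DecidableEq ((G ⧸ N) ⧸ U.map (mk' N))]
    (hAB : ∀ s ∈ l, s.1 ∈ A ∧ s.2 ∈ B) (hl : ∀ s ∈ l, s.1 ∉ U ⊔ N ∧ s.2 ∉ U ⊔ N) (n : ℕ)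
    (y : G ⧸ N) : ((h.labelHom N (pairProd l ^ n)).left y).toWord = labelWord (U.map (mk' N)) y
      ((List.replicate n l).flatten.map (Prod.map (mk' N) (mk' N))) := by
  have h1 : ∀ s ∈ (List.replicate n l).flatten, s.1 ∈ A ∧ s.2 ∈ B := by
    intro s hs
    obtain ⟨l', hl', hs'⟩ := List.mem_flatten.1 hs
    obtain rfl := List.eq_of_mem_replicate hl'
    exact hAB s hs'
  have h2 := h.labelHom_pairProd_left N h1 A.one_mem y
  rw [mul_one, pairProd_flatten_replicate] at h2
  rw [h2, FreeGroup.toWord_mk, (isReduced_pow hl n y).reduce_eq]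

theorem norm_labelHom_pow [DecidableEq ((G ⧸ N) ⧸ U.map (mk' N))]
    (hAB : ∀ s ∈ l, s.1 ∈ A ∧ s.2 ∈ B) (hl : ∀ s ∈ l, s.1 ∉ U ⊔ N ∧ s.2 ∉ U ⊔ N) (n : ℕ)
    (y : G ⧸ N) : ((h.labelHom N (pairProd l ^ n)).left y).norm = 2 * l.length * n := by
  rw [FreeGroup.norm, h.toWord_labelHom_pow hAB hl]
  simp only [length_labelWord, List.length_map, List.length_flatten, List.map_replicate,
    List.sum_replicate, smul_eq_mul]
  ring

theorem norm_labelHom_zpow [DecidableEq ((G ⧸ N) ⧸ U.map (mk' N))]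
    (hAB : ∀ s ∈ l, s.1 ∈ A ∧ s.2 ∈ B) (hl : ∀ s ∈ l, s.1 ∉ U ⊔ N ∧ s.2 ∉ U ⊔ N) (i : ℤ)
    (y : G ⧸ N) : ((h.labelHom N (pairProd l ^ i)).left y).norm = 2 * l.length * i.natAbs := by
  obtain ⟨n, rfl | rfl⟩ := i.eq_nat_or_neg
  · simpa using h.norm_labelHom_pow hAB hl n y
  · rw [zpow_neg, zpow_natCast, map_inv, inv_left]
    simp only [Pi.inv_apply, FreeGroup.norm_inv_eq, Int.natAbs_neg, Int.natAbs_natCast]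
    -- Inversion in the wreath product shifts the coordinate, which is why the length formula is
    -- needed at every `y`.
    exact h.norm_labelHom_pow hAB hl n _

/-- As the power lies in `N`, its path is closed, so a second turn reads the same label again. The
label of the doubled power is reduced, hence so is the junction of the label with itself. -/
theorem isCyclicallyReduced_labelHom_pow [DecidableEq ((G ⧸ N) ⧸ U.map (mk' N))]
    (hAB : ∀ s ∈ l, s.1 ∈ A ∧ s.2 ∈ B) (hl : ∀ s ∈ l, s.1 ∉ U ⊔ N ∧ s.2 ∉ U ⊔ N) {n : ℕ}
    (hn : pairProd l ^ n ∈ N) (y : G ⧸ N) :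
    FreeGroup.IsCyclicallyReduced ((h.labelHom N (pairProd l ^ n)).left y).toWord := by
  have h1 := isReduced_pow hl (n + n) y
  rw [List.replicate_add, List.flatten_append, List.map_append, labelWord_append,
    ← map_pairProd, pairProd_flatten_replicate, mk'_apply, (QuotientGroup.eq_one_iff _).2 hn,
    inv_one, one_mul, ← h.toWord_labelHom_pow hAB hl] at h1
  rw [FreeGroup.isCyclicallyReduced_iff]
  refine ⟨FreeGroup.isReduced_toWord, (List.isChain_append.1 h1).2.2⟩

end Hyperbolic

/-- A `p'`-isolated cyclic subgroup generated by a cyclically reduced word is `p`-separable. -/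
theorem pSeparable_zpowers_pairProd (h : IsAmalgam A B U) {l : List (G × G)} {p : ℕ} (hp : p.Prime) {F : Filter (Subgroup G)}
    [F.NeBot] (hF : ∀ᶠ N in F, NormalOfPIndex p N) (hA : SeparatedAlong F A U)
    (hB : SeparatedAlong F B U) (hA' : SeparatedAlong F A ⊥)
    (hne : l ≠ []) (hAB : ∀ s ∈ l, s.1 ∈ A ∧ s.2 ∈ B) (hl : ∀ s ∈ l, s.1 ∉ U ∧ s.2 ∉ U)
    (hiso : PPrimeIsolated p (Subgroup.zpowers (pairProd l))) :
    PSeparable p (Subgroup.zpowers (pairProd l)) := by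
  classical
  refine PSeparable.of_forall fun g hg => ?_
  have hk : 2 * l.length ≠ 0 := by simpa using hne
  -- `n` is the part prime to `p` of `2 * l.length`, the label length of `pairProd l`.
  obtain ⟨j₀, n, hpn, hkn⟩ := Nat.exists_eq_pow_mul_and_not_dvd hk p hp.ne_one
  have hn0 : n ≠ 0 := by rintro rfl; simp at hpn
  set c := pairProd l with hc
  have hgn : g ^ n ∉ Subgroup.zpowers c := fun hm => hg (hiso.mem_of_pow_mem hn0 hpn hm)
  obtain ⟨l', a', hl', -, ha', hgl'⟩ := exists_isAlternating h.le_left h.le_right (g := g ^ n)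
    (h.sup_eq_top ▸ Subgroup.mem_top _)
  have hev1 : ∀ᶠ N in F, ∀ s ∈ l, s.1 ∉ U ⊔ N ∧ s.2 ∉ U ⊔ N :=
    (Filter.eventually_all_finite l.finite_toSet).2 fun s hs =>
      (hA s.1 (hAB s hs).1 (hl s hs).1).and (hB s.2 (hAB s hs).2 (hl s hs).2)
  -- The label of `g ^ n` has length at most `2 * l'.length` for every `N`, while that of `c ^ i`
  -- has length at least `|i|`; only these `i` can occur.
  have hev2 : ∀ᶠ N : Subgroup G in F, ∀ i ∈ Set.Icc (-(2 * l'.length : ℤ)) (2 * l'.length),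
      ∀ [N.Normal], h.labelHom N (g ^ n * (c ^ i)⁻¹) ≠ 1 := by
    refine (Filter.eventually_all_finite (Set.finite_Icc _ _)).2 fun i _ => ?_
    refine h.eventually_labelHom_ne_one hA hB hA' fun h1 => hgn ⟨i, ?_⟩
    exact (mul_inv_eq_one.1 h1).symm
  obtain ⟨N, hN, hlN, hiN⟩ := (hF.and (hev1.and hev2)).exists
  have : N.Normal := hN.1
  have : Finite (G ⧸ N) := hN.finite hp
  have hθ : h.labelHom N (g ^ n) ∉ Subgroup.zpowers (h.labelHom N c) := by
    rintro ⟨i, hi⟩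
    have hi' : h.labelHom N (c ^ i) = h.labelHom N (g ^ n) := by rw [map_zpow]; exact hi
    have h1 : ((h.labelHom N (g ^ n)).left 1).norm ≤ 2 * l'.length := by
      rw [hgl', h.labelHom_pairProd_left N hl' ha']
      exact FreeGroup.norm_mk_le.trans (by simp)
    rw [← hi', h.norm_labelHom_zpow hAB hlN] at h1
    have h2 : i.natAbs ≤ 2 * l'.length :=
      (Nat.le_mul_of_pos_left _ (Nat.pos_of_ne_zero hk)).trans h1
    refine hiN i ⟨by omega, by omega⟩ ?_
    rw [map_mul, map_inv, hi', mul_inv_cancel]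
  by_contra hcon
  push Not at hcon
  have hsep : ∀ {P : Type u} [Group P] [Finite P] (ψ : G →* P), IsPGroup p P →
      ∃ i : ℤ, ψ g = ψ c ^ i := by
    intro P _ _ ψ hP
    obtain ⟨y, ⟨i, rfl⟩, hy⟩ := hcon P inferInstance inferInstance ψ hP
    exact ⟨i, by rw [← hy, map_zpow]⟩
  obtain ⟨i₀, hi₀⟩ := hsep (mk' N) hN.isPGroup
  obtain ⟨j, hj⟩ := (@IsPGroup.iff_orderOf p _ _ ⟨hp⟩).1 hN.isPGroup (c : G ⧸ N)
  set x := g * (c ^ i₀)⁻¹ with hx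
  have hxN : x ∈ N := by
    rw [← QuotientGroup.eq_one_iff, ← mk'_apply, hx, map_mul, hi₀, map_inv, map_zpow,
      mul_inv_cancel]
  have hdN : c ^ p ^ j ∈ N := by
    rw [← QuotientGroup.eq_one_iff, QuotientGroup.mk_pow, ← hj, pow_orderOf_eq_one]
  -- The exponent is a multiple of the order `p ^ j` of `c` modulo `N` because `x` is trivial there;
  -- thus `x` becomes a power of `c ^ p ^ j`.
  have hquot : ∀ (T : Type) [Group T] [Finite T]
      (τ : FreeGroup ((G ⧸ N) ⧸ U.map (mk' N)) →* T), IsPGroup p T →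
      ∃ i : ℤ, mapBase τ (h.labelHom N x) = mapBase τ (h.labelHom N c) ^ (i * (p ^ j : ℕ)) := by
    intro T _ _ τ hT
    obtain ⟨i, hi⟩ := hsep ((mapBase τ).comp (h.labelHom N))
      (RegularWreathProduct.isPGroup hp hT hN.isPGroup)
    have h1 : mapBase τ (h.labelHom N x) = mapBase τ (h.labelHom N c) ^ (i - i₀) := by
      rw [hx, map_mul, map_mul, zpow_sub, map_inv, map_inv, map_zpow, map_zpow]
      exact congrArg (· * _) hi
    have h2 : ((c : G ⧸ N)) ^ (i - i₀) = 1 := by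
      have h3 := congrArg rightHom h1
      rw [map_zpow] at h3
      simp only [rightHom_eq_right, mapBase_right, labelHom_right] at h3
      rw [← h3, (QuotientGroup.eq_one_iff x).2 hxN]
    rw [← orderOf_dvd_iff_zpow_eq_one, hj] at h2
    obtain ⟨r, hr⟩ := h2
    exact ⟨r, by rw [h1, hr, mul_comm]⟩
  have hcyc := h.isCyclicallyReduced_labelHom_pow hAB hlN hdN 1
  have hnorm := h.norm_labelHom_pow hAB hlN (p ^ j) 1
  have hxd : (h.labelHom N x).left 1 ^ n ∈
      Subgroup.zpowers ((h.labelHom N (c ^ p ^ j)).left 1) := by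
    refine FreeGroup.pow_mem_zpowers_of_forall_map_mem (p := p) hp (fun h1 => ?_) hcyc
      (j := j₀ + j) (Dvd.intro 1 ?_) fun T _ _ τ hT => ?_
    · rw [← hc, h1, FreeGroup.norm_one] at hnorm
      exact mul_ne_zero hk (pow_ne_zero j hp.ne_zero) hnorm.symm
    · rw [hnorm, hkn]
      ring
    · obtain ⟨i, hi⟩ := hquot T τ hT
      refine ⟨i, ?_⟩
      have h1 : (mapBase τ (h.labelHom N (c ^ p ^ j))).right = 1 := by
        rw [mapBase_right, labelHom_right, (QuotientGroup.eq_one_iff _).2 hdN]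
      have h2 := congrArg (fun w : T ≀ᵣ (G ⧸ N) => w.left 1) hi
      rw [mul_comm, zpow_mul, zpow_natCast, ← map_pow, ← map_pow] at h2
      simp only [left_zpow h1] at h2
      exact h2.symm
  obtain ⟨r, hr⟩ := hxd
  -- A nontrivial commutator lies in the base group, so one of its coordinates survives in a finite
  -- `p`-quotient, where `x` is nevertheless a power of `c`.
  have hcomm : Commute (h.labelHom N x) (h.labelHom N c) := by
    rw [← commutatorElement_eq_one_iff_commute, ← map_commutatorElement]
    by_contra hne1
    have h1 : (h.labelHom N ⁅x, c⁆).right = 1 := by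
      rw [labelHom_right, QuotientGroup.eq_one_iff]
      exact Subgroup.commutator_le_left N ⊤
        (Subgroup.commutator_mem_commutator hxN (Subgroup.mem_top c))
    obtain ⟨y, hy⟩ : ∃ y, (h.labelHom N ⁅x, c⁆).left y ≠ 1 := by
      by_contra hall
      push Not at hall
      exact hne1 (RegularWreathProduct.ext (funext hall) h1)
    obtain ⟨T, _, _, τ, hT, hτ⟩ := FreeGroup.exists_isPGroup_map_ne_one hp hy
    obtain ⟨i, hi⟩ := hquot T τ hT
    apply hτ
    rw [← mapBase_left, map_commutatorElement, map_commutatorElement,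
      commutatorElement_eq_one_iff_commute.2]
    · rfl
    · rw [hi]
      exact (Commute.refl _).zpow_left _
  have hpow : h.labelHom N x ^ n = h.labelHom N (c ^ p ^ j) ^ r := by
    have h1 : (h.labelHom N x).right = 1 := by
      rw [labelHom_right, (QuotientGroup.eq_one_iff _).2 hxN]
    have h2 : (h.labelHom N (c ^ p ^ j)).right = 1 := by
      rw [labelHom_right, (QuotientGroup.eq_one_iff _).2 hdN]
    -- The relation is known at coordinate `1` only; `labelHom_eq_one` spreads it to the others.
    have h3 : h.labelHom N (x ^ n * ((c ^ p ^ j) ^ r)⁻¹) = 1 := by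
      refine h.labelHom_eq_one N (mul_mem (pow_mem hxN n) (inv_mem (zpow_mem hdN r))) ?_
      rw [map_mul, map_pow, map_inv, map_zpow, ← zpow_natCast, ← zpow_neg, mul_left]
      have h4 : (h.labelHom N x ^ (n : ℤ)).right = 1 := by
        rw [zpow_natCast, ← map_pow, labelHom_right, (QuotientGroup.eq_one_iff _).2 (pow_mem hxN n)]
      simp only [Pi.mul_apply, h4, inv_one, one_mul]
      rw [left_zpow h1, left_zpow h2, zpow_natCast, zpow_neg, mul_inv_eq_one]
      exact hr.symm
    rwa [map_mul, map_inv, mul_inv_eq_one, map_pow, map_zpow] at h3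
  apply hθ
  have hg' : g = x * c ^ i₀ := by rw [hx, inv_mul_cancel_right]
  rw [map_pow, hg', map_mul, map_zpow, (hcomm.zpow_right i₀).mul_pow, hpow, map_pow]
  refine mul_mem (zpow_mem (pow_mem (Subgroup.mem_zpowers _) _) _)
    (pow_mem (zpow_mem (Subgroup.mem_zpowers _) _) _)

end IsAmalgam

/-! ### Transfer along conjugation and the case of elements conjugate into a factor. -/

theorem PSeparable.of_map_equiv {p : ℕ} {X : Type u} [Group X] {C : Subgroup X} (e : X ≃* X)
    (h : PSeparable p (C.map e.toMonoidHom)) : PSeparable p C := by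
  refine PSeparable.of_forall fun g hg => ?_
  obtain ⟨P, i, j, ψ, hP, -, h1⟩ := h (e g) (by
    rintro ⟨x, hx, h2⟩
    exact hg (e.injective h2 ▸ hx))
  refine ⟨P, i, j, ψ.comp e.toMonoidHom, hP, ?_⟩
  rintro ⟨x, hx, h2⟩
  exact h1 ⟨e x, ⟨x, hx, rfl⟩, h2⟩

theorem PPrimeIsolated.map_equiv {p : ℕ} {X : Type u} [Group X] {C : Subgroup X} (e : X ≃* X)
    (h : PPrimeIsolated p C) : PPrimeIsolated p (C.map e.toMonoidHom) := by
  rintro g q hq hqp ⟨x, hx, h1⟩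
  refine ⟨e.symm g, h _ q hq hqp ?_, e.apply_symm_apply g⟩
  rw [← map_pow, ← h1]
  simpa using hx

theorem PPrimeIsolated.of_map {p : ℕ} {X : Type u} {Y : Type v} [Group X] [Group Y] {ι : X →* Y}
    (hι : Function.Injective ι) {C : Subgroup X} (h : PPrimeIsolated p (C.map ι)) :
    PPrimeIsolated p C := by
  intro g q hq hqp hg
  obtain ⟨x, hx, h1⟩ := h (ι g) q hq hqp ⟨g ^ q, hg, map_pow ι g q⟩
  exact hι h1 ▸ hx

theorem normalOfPIndex_ker {p : ℕ} (hp : p.Prime) {X : Type u} {P : Type v} [Group X] [Group P]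
    [Finite P] (hP : IsPGroup p P) (ψ : X →* P) : NormalOfPIndex p ψ.ker := by
  have : Fact p.Prime := ⟨hp⟩
  refine ⟨inferInstance, ?_⟩
  rw [Subgroup.index_ker]
  exact IsPGroup.iff_card.1 (hP.to_subgroup ψ.range)

theorem NormalOfPIndex.inf {p : ℕ} (hp : p.Prime) {X : Type u} [Group X] {M N : Subgroup X}
    (hM : NormalOfPIndex p M) (hN : NormalOfPIndex p N) : NormalOfPIndex p (M ⊓ N) := by
  have : Fact p.Prime := ⟨hp⟩
  have : M.Normal := hM.1
  have : N.Normal := hN.1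
  have : Finite (X ⧸ M) := hM.finite hp
  have : Finite (X ⧸ N) := hN.finite hp
  obtain ⟨i, hi⟩ := hM.2
  obtain ⟨j, hj⟩ := hN.2
  have h := normalOfPIndex_ker hp (IsPGroup.of_card (n := i + j)
    (by rw [Nat.card_prod, pow_add, ← hi, ← hj]; rfl))
    ((QuotientGroup.mk' M).prod (QuotientGroup.mk' N))
  rwa [MonoidHom.ker_prod, QuotientGroup.ker_mk', QuotientGroup.ker_mk'] at h

theorem normalOfPIndex_top (p : ℕ) (X : Type u) [Group X] :
    NormalOfPIndex p (⊤ : Subgroup X) :=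
  ⟨inferInstance, 0, by simp⟩

/-- Isolation descends along the injection to the subgroup of the conjugate `a`. As that subgroup is
excluded from `DeltaP p A`, it must be `p`-separable in `A`, and `pSeparable_of_le_left` applies. -/
theorem IsAmalgam.pSeparable_of_isConj_left {p : ℕ} (hp : p.Prime) {A : Type v} [Group A]
    {G : Type u} [Group G] {ι : A →* G} (hι : Function.Injective ι) {B U : Subgroup G}
    (h : IsAmalgam ι.range B U) {F : Filter (Subgroup G)} [F.NeBot]
    (hF : ∀ᶠ N in F, NormalOfPIndex p N) (hA : SeparatedAlong F ι.range U)
    (hB : SeparatedAlong F B U)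
    (hsep : ∀ D : Subgroup A, PSeparable p D → SeparatedAlong F ι.range (D.map ι)) {c : G}
    (hiso : PPrimeIsolated p (Subgroup.zpowers c))
    (hΔ : ∀ D ∈ DeltaP p A, ¬ ConjugateSubgroups (Subgroup.zpowers c) (D.map ι))
    (hc : ∃ x ∈ ι.range, IsConj c x) : PSeparable p (Subgroup.zpowers c) := by
  obtain ⟨_, ⟨a, rfl⟩, hca⟩ := hc
  obtain ⟨t, ht⟩ := isConj_iff.1 hca
  have hmap : (Subgroup.zpowers c).map (MulAut.conj t).toMonoidHom =
      (Subgroup.zpowers a).map ι := by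
    rw [MonoidHom.map_zpowers, MonoidHom.map_zpowers, ← ht]
    rfl
  have hD : PSeparable p (Subgroup.zpowers a) := by
    by_contra hns
    refine hΔ (Subgroup.zpowers a) ⟨inferInstance, PPrimeIsolated.of_map hι ?_, hns⟩ ⟨t⁻¹, ?_⟩
    · rw [← hmap]
      exact hiso.map_equiv _
    · rw [← hmap, MonoidHom.map_zpowers, MonoidHom.map_zpowers]
      congr 1
      simp [mul_assoc]
  refine PSeparable.of_map_equiv (MulAut.conj t) ?_
  have h1 := h.pSeparable_of_le_left hp hF hA hB (D := (Subgroup.zpowers a).map ι)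
    (by rw [MonoidHom.range_eq_map]; exact Subgroup.map_mono le_top) (hsep _ hD)
  rw [← hmap] at h1
  exact h1

/-! ### The concrete amalgam and the filter of small normal subgroups. -/

namespace Amalgam

variable {A : Type u} {B : Type v} [Group A] [Group B] {H : Subgroup A} {K : Subgroup B}

theorem inl_eq_inr (φ : H ≃* K) (x : H) : inl φ (x : A) = inr φ (φ x : B) := by
  have h : (Monoid.Coprod.inl (x : A) * (Monoid.Coprod.inr (φ x : B))⁻¹ : Monoid.Coprod A B) ∈
      amalgamKernel φ := Subgroup.subset_normalClosure ⟨x, rfl⟩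
  have h1 := (QuotientGroup.eq_one_iff _).2 h
  rw [QuotientGroup.mk_mul, QuotientGroup.mk_inv, mul_inv_eq_one] at h1
  exact h1

theorem map_inl_eq_map_inr (φ : H ≃* K) : H.map (inl φ) = K.map (inr φ) := by
  ext x
  constructor
  · rintro ⟨a, ha, rfl⟩
    exact ⟨φ ⟨a, ha⟩, (φ ⟨a, ha⟩).2, (inl_eq_inr φ ⟨a, ha⟩).symm⟩
  · rintro ⟨b, hb, rfl⟩
    refine ⟨φ.symm ⟨b, hb⟩, (φ.symm ⟨b, hb⟩).2, ?_⟩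
    rw [inl_eq_inr, MulEquiv.apply_symm_apply]

theorem isAmalgam (φ : H ≃* K) :
    IsAmalgam (inl φ).range (inr φ).range (H.map (inl φ)) where
  le_left := by rw [MonoidHom.range_eq_map]; exact Subgroup.map_mono le_top
  le_right := by
    rw [map_inl_eq_map_inr, MonoidHom.range_eq_map]
    exact Subgroup.map_mono le_top
  sup_eq_top := by
    rw [inl, inr, MonoidHom.range_comp, MonoidHom.range_comp, ← Subgroup.map_sup,
      Monoid.Coprod.range_inl_sup_range_inr, ← MonoidHom.range_eq_map,
      MonoidHom.range_eq_top.2 (QuotientGroup.mk'_surjective _)]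
  exists_hom W _ f g hfg := by
    let θ : Monoid.Coprod A B →* W := Monoid.Coprod.lift (f.comp (inl φ)) (g.comp (inr φ))
    have hθ : amalgamKernel φ ≤ θ.ker := by
      refine Subgroup.normalClosure_le_normal ?_
      rintro _ ⟨x, rfl⟩
      have h1 := hfg (inl φ (x : A)) ⟨x, x.2, rfl⟩
      simp only [SetLike.mem_coe, MonoidHom.mem_ker, map_mul, map_inv, mul_inv_eq_one]
      simp only [θ, Monoid.Coprod.lift_apply_inl, Monoid.Coprod.lift_apply_inr,
        MonoidHom.comp_apply]
      rw [h1, inl_eq_inr]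
    refine ⟨QuotientGroup.lift _ θ hθ, ?_, ?_⟩
    · rintro _ ⟨a, rfl⟩
      exact Monoid.Coprod.lift_apply_inl (f.comp (inl φ)) (g.comp (inr φ)) a
    · rintro _ ⟨b, rfl⟩
      exact Monoid.Coprod.lift_apply_inr (f.comp (inl φ)) (g.comp (inr φ)) b

/-- The filter generated by the sets of the normal subgroups of finite `p`-index whose
intersections with the factors lie in given normal subgroups of finite `p`-index. -/
def pFilter (p : ℕ) (φ : H ≃* K) : Filter (Subgroup (Amalgam φ)) :=
  ⨅ MN : {MN : Subgroup A × Subgroup B // NormalOfPIndex p MN.1 ∧ NormalOfPIndex p MN.2},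
    Filter.principal {N | NormalOfPIndex p N ∧ N.comap (inl φ) ≤ MN.1.1 ∧
      N.comap (inr φ) ≤ MN.1.2}

variable {p : ℕ} {φ : H ≃* K}

theorem eventually_pFilter {M : Subgroup A} {N : Subgroup B} (hM : NormalOfPIndex p M)
    (hN : NormalOfPIndex p N) : ∀ᶠ L in pFilter p φ, NormalOfPIndex p L ∧
      L.comap (inl φ) ≤ M ∧ L.comap (inr φ) ≤ N :=
  Filter.mem_iInf_of_mem ⟨(M, N), hM, hN⟩ (Filter.mem_principal_self _)

theorem eventually_normalOfPIndex : ∀ᶠ L in pFilter p φ, NormalOfPIndex p L :=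
  (eventually_pFilter (normalOfPIndex_top p A) (normalOfPIndex_top p B)).mono fun _ h => h.1

/-- Intersections of subgroups of finite `p`-index make the family directed; the hypothesis on
`OmegaP` says that each of its sets is nonempty. -/
theorem pFilter_neBot (hp : p.Prime)
    (hΩ : ∀ (M : Subgroup A) (N : Subgroup B), NormalOfPIndex p M → NormalOfPIndex p N →
      ∃ RS ∈ OmegaP p φ, RS.1 ≤ M ∧ RS.2 ≤ N) : (pFilter p φ).NeBot := by
  have : Nonempty {MN : Subgroup A × Subgroup B // NormalOfPIndex p MN.1 ∧
    NormalOfPIndex p MN.2} := ⟨⟨(⊤, ⊤), normalOfPIndex_top p A, normalOfPIndex_top p B⟩⟩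
  refine Filter.iInf_neBot_of_directed' ?_ ?_
  · rintro ⟨⟨M, N⟩, hM, hN⟩ ⟨⟨M', N'⟩, hM', hN'⟩
    refine ⟨⟨(M ⊓ M', N ⊓ N'), hM.inf hp hM', hN.inf hp hN'⟩, ?_, ?_⟩
    · exact Filter.principal_mono.2 fun L h =>
        ⟨h.1, h.2.1.trans inf_le_left, h.2.2.trans inf_le_left⟩
    · exact Filter.principal_mono.2 fun L h =>
        ⟨h.1, h.2.1.trans inf_le_right, h.2.2.trans inf_le_right⟩
  · rintro ⟨⟨M, N⟩, hM, hN⟩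
    obtain ⟨_, ⟨L, hL, rfl⟩, h1, h2⟩ := hΩ M N hM hN
    exact Filter.principal_neBot_iff.2 ⟨L, hL, h1, h2⟩

/-- If the preimages under `ι` of the members of a filter become arbitrarily small, then an element
outside a `p`-separable subgroup is separated from it modulo the small members of the filter. -/
theorem eventually_notMem_sup (hp : p.Prime) {X : Type u} {G : Type v} [Group X] [Group G]
    {ι : X →* G} {F : Filter (Subgroup G)} (hF : ∀ᶠ L in F, NormalOfPIndex p L)
    (hι : ∀ M : Subgroup X, NormalOfPIndex p M → ∀ᶠ L in F, L.comap ι ≤ M) {D : Subgroup X}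
    (hD : PSeparable p D) {x : X} (hx : x ∉ D) : ∀ᶠ L in F, ι x ∉ D.map ι ⊔ L := by
  obtain ⟨P, _, _, ψ, hP, -, h1⟩ := hD x hx
  filter_upwards [hF, hι _ (normalOfPIndex_ker hp hP ψ)] with L hL hLM hm
  have : L.Normal := hL.1
  obtain ⟨_, ⟨d, hd, rfl⟩, z, hz, hdz⟩ := Subgroup.mem_sup_of_normal_right.1 hm
  have h2 : d⁻¹ * x ∈ ψ.ker := hLM (by
    rw [Subgroup.mem_comap, map_mul, map_inv, ← hdz, inv_mul_cancel_left]
    exact hz)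
  rw [MonoidHom.mem_ker, map_mul, map_inv, inv_mul_eq_one] at h2
  exact h1 ⟨d, hd, h2⟩

theorem separatedAlong_map (hp : p.Prime) {X : Type u} {G : Type v} [Group X] [Group G]
    {ι : X →* G} {F : Filter (Subgroup G)} (hF : ∀ᶠ L in F, NormalOfPIndex p L)
    (hι : ∀ M : Subgroup X, NormalOfPIndex p M → ∀ᶠ L in F, L.comap ι ≤ M) {D : Subgroup X}
    (hD : PSeparable p D) : SeparatedAlong F ι.range (D.map ι) := by
  rintro _ ⟨x, rfl⟩ hx
  exact eventually_notMem_sup hp hF hι hD fun hxD => hx ⟨x, hxD, rfl⟩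

/-- An element killed by `ι` lies in the preimage of every `L`, and these preimages become
arbitrarily small. No normal form theorem for amalgams is needed. -/
theorem injective_of_residuallyPFinite (hp : p.Prime) {X : Type u} {G : Type v} [Group X] [Group G]
    {ι : X →* G} {F : Filter (Subgroup G)} [F.NeBot] (hF : ∀ᶠ L in F, NormalOfPIndex p L)
    (hι : ∀ M : Subgroup X, NormalOfPIndex p M → ∀ᶠ L in F, L.comap ι ≤ M)
    (hX : ResiduallyPFinite p X) : Function.Injective ι := by
  refine (injective_iff_map_eq_one ι).2 fun x hx => ?_
  by_contra hne
  obtain ⟨L, hL⟩ := (eventually_notMem_sup hp hF hι hX (x := x) (by simpa using hne)).exists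
  exact hL (hx ▸ one_mem _)

end Amalgam

/-! ### The main theorem. -/

theorem theorem1p7 (p : ℕ) (hp : p.Prime) {A : Type u} {B : Type v} [Group A] [Group B]
    (H : Subgroup A) (K : Subgroup B) (φ : H ≃* K)
    (hA : ResiduallyPFinite p A) (hB : ResiduallyPFinite p B)
    (hH : PSeparable p H) (hK : PSeparable p K)
    (hΩ : ∀ (M : Subgroup A) (N : Subgroup B), NormalOfPIndex p M → NormalOfPIndex p N →
      ∃ RS ∈ OmegaP p φ, RS.1 ≤ M ∧ RS.2 ≤ N) :
    ConditionStarStar p φ := by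
  intro C hC hiso hΔA hΔB
  obtain ⟨c, rfl⟩ := (Subgroup.isCyclic_iff_exists_zpowers_eq_top C).1 hC
  have : (Amalgam.pFilter p φ).NeBot := Amalgam.pFilter_neBot hp hΩ
  have hF : ∀ᶠ L in Amalgam.pFilter p φ, NormalOfPIndex p L := Amalgam.eventually_normalOfPIndex
  have hl : ∀ M : Subgroup A, NormalOfPIndex p M →
      ∀ᶠ L in Amalgam.pFilter p φ, L.comap (Amalgam.inl φ) ≤ M := fun M hM =>
    (Amalgam.eventually_pFilter hM (normalOfPIndex_top p B)).mono fun _ h => h.2.1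
  have hr : ∀ N : Subgroup B, NormalOfPIndex p N →
      ∀ᶠ L in Amalgam.pFilter p φ, L.comap (Amalgam.inr φ) ≤ N := fun N hN =>
    (Amalgam.eventually_pFilter (normalOfPIndex_top p A) hN).mono fun _ h => h.2.2
  have hinl := Amalgam.injective_of_residuallyPFinite hp hF hl hA
  have hinr := Amalgam.injective_of_residuallyPFinite hp hF hr hB
  have hsA := Amalgam.separatedAlong_map hp hF hl hH
  have hsB := Amalgam.separatedAlong_map hp hF hr hK
  rw [← Amalgam.map_inl_eq_map_inr] at hsB
  have hamal := Amalgam.isAmalgam φ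
  by_cases hcA : ∃ x ∈ (Amalgam.inl φ).range, IsConj c x
  · exact hamal.pSeparable_of_isConj_left hp hinl hF hsA hsB
      (fun _ hD => Amalgam.separatedAlong_map hp hF hl hD) hiso hΔA hcA
  by_cases hcB : ∃ x ∈ (Amalgam.inr φ).range, IsConj c x
  · exact hamal.symm.pSeparable_of_isConj_left hp hinr hF hsB hsA
      (fun _ hD => Amalgam.separatedAlong_map hp hF hr hD) hiso hΔB hcB
  push Not at hcA hcB
  obtain ⟨l, hne, hAB, hlU, hcl⟩ :=
    exists_isConj_pairProd hamal.le_left hamal.le_right hamal.sup_eq_top hcA hcB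
  obtain ⟨t, ht⟩ := isConj_iff.1 hcl
  have hmap : (Subgroup.zpowers c).map (MulAut.conj t).toMonoidHom =
      Subgroup.zpowers (pairProd l) := by
    rw [MonoidHom.map_zpowers, ← ht]
    rfl
  -- Residual `p`-finiteness of `A` is separability of the trivial subgroup, which keeps nontrivial
  -- elements of the first factor nontrivial modulo small `N`.
  have hbot := Amalgam.separatedAlong_map hp hF hl hA
  rw [Subgroup.map_bot] at hbot
  refine PSeparable.of_map_equiv (MulAut.conj t) ?_
  have hiso' := hiso.map_equiv (MulAut.conj t)
  have h1 := hamal.pSeparable_zpowers_pairProd hp hF hsA hsB hbot hne hAB hlU (hmap ▸ hiso')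
  rw [← hmap] at h1
  exact h1
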